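/- Let $d\in\mathbb N$, $Y=[0,2\pi)^d$, and write $\mathcal M_Y(f)=\frac1{|Y|}\int_Y f\,dy$. Let $A=(a_{kl})_{k,l=1}^d$ be a symmetric matrix of real, bounded, measurable, $2\pi\mathbb Z^d$-periodic functions on $\mathbb R^d$ for which there is $\alpha>0$ with $A(y)\xi\cdot\xi\ge\alpha|\xi|^2$ for all $\xi\in\mathbb R^d$ and a.e. $y$. Let $H^s_\sharp(Y)$ ($s=1,2$) denote the Sobolev spaces of real-valued $2\pi\mathbb Z^d$-periodic functions, and put $V_\rho=H^2_\sharp(Y)$ for $\rho>0$ and $V_0=H^1_\sharp(Y)$. For every $0\le\rho<\infty$ and $1\le j\le d$ the cell problem $$\rho^2\Delta^2\chi_j^\rho-\operatorname{div}A(y)(e_j+\nabla\chi_j^\rho)=0,\qquad \chi_j^\rho\ \ Y\text{-periodic},\qquad \mathcal M_Y(\chi_j^\rho)=0,$$ understood weakly, i.e. $\chi^\rho_j\in V_\rho$, $\mathcal M_Y(\chi_j^\rho)=0$ and $$\rho^2\int_Y\Delta\chi_j^\rho\,\Delta v\,dy+\int_Y A(e_j+\nabla\chi_j^\rho)\cdot\nabla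 v\,dy=0\qquad\text{for all }v\in V_\rho$$ (the first term being absent for $\rho=0$), has a solution, unique up to equality almost everywhere. Define $A^{\rho,\mathrm{hom}}=\mathcal M_Y(A+A\nabla\chi^\rho)$, i.e. $A^{\rho,\mathrm{hom}}e_l=\mathcal M_Y\big(A(e_l+\nabla\chi_l^\rho)\big)$ for $1\le l\le d$. Let $\theta\in[0,\infty]$, and set $A^{\mathrm{hom}}=A^{\theta,\mathrm{hom}}$ if $\theta<\infty$ and $A^{\mathrm{hom}}=\mathcal M_Y(A)$ if $\theta=\infty$. Then $A^{\rho,\mathrm{hom}}\to A^{\mathrm{hom}}$ as $\rho\to\theta$ with $0\le\rho<\infty$. -/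

import Mathlib

open MeasureTheory Filter Topology
open scoped NNReal ENNReal Matrix

namespace PeriodicHom

noncomputable section

/-- The periodicity cell `Y = [0, 2π)^d`. -/
def cell (d : ℕ) : Set (Fin d → ℝ) :=
  Set.pi Set.univ (fun _ => Set.Ico 0 (2 * Real.pi))

/-- The lattice translate `y + 2πp` of `y`. -/
def shift {d : ℕ} (p : Fin d → ℤ) (y : Fin d → ℝ) : Fin d → ℝ :=
  fun i => y i + 2 * Real.pi * (p i : ℝ)

/-- `f` is `Y`-periodic (as a function defined almost everywhere). -/
def AEPeriodic {d : ℕ} {E : Type*} (f : (Fin d → ℝ) → E) : Prop :=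
  ∀ p : Fin d → ℤ, ∀ᵐ y : Fin d → ℝ, f (shift p y) = f y

/-- The standing hypotheses on the coefficient matrix: entries real, bounded and measurable;
uniform ellipticity; periodicity; symmetry. -/
structure IsAdmissible {d : ℕ} (A : (Fin d → ℝ) → Matrix (Fin d) (Fin d) ℝ) : Prop where
  measurable : ∀ k l, AEMeasurable (fun y => A y k l)
  bounded : ∃ M : ℝ, ∀ᵐ y : Fin d → ℝ, ∀ k l, |A y k l| ≤ M
  elliptic : ∃ α : ℝ, 0 < α ∧
    ∀ᵐ y : Fin d → ℝ, ∀ ξ : Fin d → ℝ, α * (ξ ⬝ᵥ ξ) ≤ (A y *ᵥ ξ) ⬝ᵥ ξ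
  periodic : AEPeriodic A
  symmetric : ∀ᵐ y : Fin d → ℝ, (A y).IsSymm

/-- The space `L²_♯(Y)` of (real) periodic functions that are square integrable on `Y`. -/
def MemL2 {d : ℕ} (u : (Fin d → ℝ) → ℝ) : Prop :=
  AEPeriodic u ∧ MemLp u 2 (volume.restrict (cell d))

/-- Smooth periodic test functions, the space `C^∞_♯(Y)`. -/
def IsTest {d : ℕ} (φ : (Fin d → ℝ) → ℝ) : Prop :=
  ContDiff ℝ ((⊤ : ℕ∞) : WithTop ℕ∞) φ ∧ ∀ (p : Fin d → ℤ) (y : Fin d → ℝ), φ (shift p y) = φ y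

/-- `g ∈ L²_♯(Y)` is the weak partial derivative `∂u/∂y_m` of the periodic function `u`. -/
def IsWeakPartial {d : ℕ} (m : Fin d) (u g : (Fin d → ℝ) → ℝ) : Prop :=
  MemL2 g ∧ ∀ φ : (Fin d → ℝ) → ℝ, IsTest φ →
    ∫ y in cell d, u y * fderiv ℝ φ y (Pi.single m 1) = - ∫ y in cell d, g y * φ y

/-- The Sobolev space `H¹_♯(Y)`. -/
def MemH1 {d : ℕ} (u : (Fin d → ℝ) → ℝ) : Prop :=
  MemL2 u ∧ ∀ m, ∃ g, IsWeakPartial m u g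

/-- The Sobolev space `H²_♯(Y)`. -/
def MemH2 {d : ℕ} (u : (Fin d → ℝ) → ℝ) : Prop :=
  MemL2 u ∧ ∀ m, ∃ g, IsWeakPartial m u g ∧ MemH1 g

open Classical in
/-- The weak partial derivative `∂u/∂y_m` (determined up to null sets when it exists). -/
def weakPartial {d : ℕ} (m : Fin d) (u : (Fin d → ℝ) → ℝ) : (Fin d → ℝ) → ℝ :=
  if h : ∃ g, IsWeakPartial m u g then h.choose else 0

/-- The weak gradient. -/
def weakGrad {d : ℕ} (u : (Fin d → ℝ) → ℝ) (y : Fin d → ℝ) : Fin d → ℝ :=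
  fun m => weakPartial m u y

/-- The weak Laplacian of a function in `H²_♯(Y)`. -/
def weakLaplacian {d : ℕ} (u : (Fin d → ℝ) → ℝ) (y : Fin d → ℝ) : ℝ :=
  ∑ m, weakPartial m (weakPartial m u) y

/-- The energy space of `ρ²Δ² - div A∇`: it is `H²_♯(Y)` for `ρ ≠ 0` and `H¹_♯(Y)` for `ρ = 0`. -/
def MemEnergy {d : ℕ} (ρ : ℝ) (u : (Fin d → ℝ) → ℝ) : Prop :=
  (ρ = 0 ∧ MemH1 u) ∨ (ρ ≠ 0 ∧ MemH2 u)

/-- `χ` is a weak solution of the cell problem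
`ρ²Δ²χ - div A(e_j + ∇χ) = 0`, `χ` periodic with mean zero. -/
def IsCorrector {d : ℕ} (A : (Fin d → ℝ) → Matrix (Fin d) (Fin d) ℝ) (ρ : ℝ) (j : Fin d)
    (χ : (Fin d → ℝ) → ℝ) : Prop :=
  MemEnergy ρ χ ∧ (⨍ y in cell d, χ y) = 0 ∧
    ∀ v : (Fin d → ℝ) → ℝ, MemEnergy ρ v →
      ρ ^ 2 * (∫ y in cell d, weakLaplacian χ y * weakLaplacian v y) +
        (∫ y in cell d, (A y *ᵥ (Pi.single j 1 + weakGrad χ y)) ⬝ᵥ weakGrad v y) = 0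

open Classical in
/-- The corrector `χ_j^ρ` (determined up to null sets). -/
def corrector {d : ℕ} (A : (Fin d → ℝ) → Matrix (Fin d) (Fin d) ℝ) (ρ : ℝ) (j : Fin d) :
    (Fin d → ℝ) → ℝ :=
  if h : ∃ χ, IsCorrector A ρ j χ then h.choose else 0

/-- The mean `M_Y(A)`. -/
def meanMatrix {d : ℕ} (A : (Fin d → ℝ) → Matrix (Fin d) (Fin d) ℝ) :
    Matrix (Fin d) (Fin d) ℝ :=
  Matrix.of fun k l => ⨍ y in cell d, A y k l

/-- `A^{ρ,hom} = M_Y(A + A∇χ^ρ)`; its `l`-th column is `M_Y(A(e_l + ∇χ_l^ρ))`. -/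
def homTensor {d : ℕ} (A : (Fin d → ℝ) → Matrix (Fin d) (Fin d) ℝ) (ρ : ℝ) :
    Matrix (Fin d) (Fin d) ℝ :=
  Matrix.of fun k l => ⨍ y in cell d, (A y k l + (A y *ᵥ weakGrad (corrector A ρ l) y) k)

open Classical in
/-- The homogenized tensor `A^{hom}` in the regime `ρ → θ ∈ [0, ∞]`. -/
def limitTensor {d : ℕ} (A : (Fin d → ℝ) → Matrix (Fin d) (Fin d) ℝ) (θ : ℝ≥0∞) :
    Matrix (Fin d) (Fin d) ℝ :=
  if θ = ⊤ then meanMatrix A else homTensor A θ.toReal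

end

end PeriodicHom

/-! On the cell, write `D` for the Laplacian, `T` for the gradient and `b p q = ∫ A p · q` for the
form on square integrable vector fields. The cell problem reads `ρ² ⟪D x, D v⟫ + b (T x) (T v) = f
(T v)` with `f = -b e_j`, and ellipticity gives `α ‖p‖² ≤ b p p`. The homogenized tensor is a
continuous affine function of the corrector gradient (`homTensor_apply`), equal to `M_Y(A)` when the
gradient is zero. So everything reduces to the dependence of the gradient `p ρ` on `ρ` in `L²`.

Well-posedness is Lax–Milgram on mean-zero Sobolev spaces. The coercivity constants come from
Parseval: a weak derivative in direction `m` multiplies the energy of the mode `k` by `k_m²`, and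
nonzero integer frequencies satisfy `|k|² ≥ 1`. This yields `norm_sq_le_grad1` and
`norm_sq_le_laplacian2`.

Convergence has three regimes. For `0 < θ < ∞`, subtracting the equations for two parameters gives a
stability bound (`perturbed_stability`). For `θ = ∞`, the energy bound on `ρ² ‖D x‖²` together with
the control of `x` by `D x` forces the gradients to zero (`tendsto_perturbed_atTop`). For `θ = 0`
the perturbation is singular, since the limit gradient need not come from `H²`. It is approximated
by some `T z` with `z` in `H²`, which is possible by `grad1_mem_closure_range_grad2`; the error is
of order `ρ² ‖D z‖² + ‖T z - p 0‖²` (`perturbed_approx`), and `z` is fixed before `ρ` tends to `0`.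
-/

namespace PeriodicHom

/-! ### The periodicity cell and periodic functions -/

/-- Lebesgue measure on the periodicity cell. -/
noncomputable abbrev cellMeasure (d : ℕ) : Measure (Fin d → ℝ) := volume.restrict (cell d)

theorem measurableSet_cell (d : ℕ) : MeasurableSet (cell d) :=
  MeasurableSet.univ_pi fun _ => measurableSet_Ico

theorem cell_ae_eq_Icc (d : ℕ) :
    cell d =ᵐ[volume] Set.Icc (fun _ => (0 : ℝ)) (fun _ => 2 * Real.pi) :=
  Measure.univ_pi_Ico_ae_eq_Icc

theorem cell_ae_eq_Ioc (d : ℕ) :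
    cell d =ᵐ[volume] Set.pi Set.univ (fun _ => Set.Ioc (0 : ℝ) (2 * Real.pi)) :=
  (cell_ae_eq_Icc d).trans Measure.univ_pi_Ioc_ae_eq_Icc.symm

theorem volume_cell (d : ℕ) : volume (cell d) = ENNReal.ofReal (2 * Real.pi) ^ d := by
  simp [cell, volume_pi, Measure.pi_pi]

instance (d : ℕ) : IsFiniteMeasure (cellMeasure d) :=
  ⟨by
    rw [Measure.restrict_apply_univ, volume_cell]
    exact ENNReal.pow_lt_top ENNReal.ofReal_lt_top⟩

theorem volume_real_cell (d : ℕ) : volume.real (cell d) = (2 * Real.pi) ^ d := by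
  simp [Measure.real, volume_cell, ENNReal.toReal_pow, Real.pi_pos.le]

/-- Reduction of a point modulo the period lattice to the periodicity cell. -/
noncomputable def reduce {d : ℕ} (y : Fin d → ℝ) : Fin d → ℝ :=
  fun i => toIcoMod Real.two_pi_pos 0 (y i)

theorem reduce_mem_cell {d : ℕ} (y : Fin d → ℝ) : reduce y ∈ cell d := by
  intro i _
  simpa [reduce] using toIcoMod_mem_Ico Real.two_pi_pos 0 (y i)

theorem reduce_of_mem_cell {d : ℕ} {y : Fin d → ℝ} (hy : y ∈ cell d) : reduce y = y := by
  funext i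
  exact (toIcoMod_eq_self Real.two_pi_pos).2 (by simpa using hy i trivial)

theorem reduce_shift {d : ℕ} (p : Fin d → ℤ) (y : Fin d → ℝ) : reduce (shift p y) = reduce y := by
  funext i
  have h := toIcoMod_add_zsmul Real.two_pi_pos 0 (y i) (p i)
  rw [zsmul_eq_mul, mul_comm ((p i : ℤ) : ℝ)] at h
  exact h

theorem exists_shift_reduce {d : ℕ} (y : Fin d → ℝ) : ∃ p : Fin d → ℤ, shift p (reduce y) = y := by
  refine ⟨fun i => toIcoDiv Real.two_pi_pos 0 (y i), ?_⟩
  funext i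
  have h := toIcoMod_add_toIcoDiv_zsmul Real.two_pi_pos 0 (y i)
  rw [zsmul_eq_mul, mul_comm ((toIcoDiv _ _ _ : ℤ) : ℝ)] at h
  exact h

theorem measurePreserving_shift {d : ℕ} (p : Fin d → ℤ) :
    MeasurePreserving (shift p : (Fin d → ℝ) → Fin d → ℝ) volume volume :=
  measurePreserving_add_right volume (fun i => 2 * Real.pi * (p i : ℝ))

/-- The space is covered by the lattice translates of the cell. There are countably many, so the
union of their exceptional null sets is still null. -/
theorem AEPeriodic.ae_eq {d : ℕ} {E : Type*} {f g : (Fin d → ℝ) → E} (hf : AEPeriodic f)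
    (hg : AEPeriodic g) (h : f =ᵐ[cellMeasure d] g) : f =ᵐ[volume] g := by
  have key : ∀ p : Fin d → ℤ, ∀ᵐ y : Fin d → ℝ, shift (-p) y ∈ cell d → f y = g y := by
    intro p
    have h1 : ∀ᵐ y : Fin d → ℝ, y ∈ cell d → f (shift p y) = g (shift p y) := by
      filter_upwards [hf p, hg p, (ae_restrict_iff' (measurableSet_cell d)).1 h] with y a b c hy
      rw [a, b, c hy]
    filter_upwards [(measurePreserving_shift (-p)).quasiMeasurePreserving.ae h1] with y hy hc
    have e : shift p (shift (-p) y) = y := by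
      funext i
      simp [shift]
    simpa [e] using hy hc
  filter_upwards [ae_all_iff.2 key] with y hy
  obtain ⟨p, hp⟩ := exists_shift_reduce y
  refine hy p ?_
  have e : shift (-p) y = reduce y := by
    rw [← hp]
    funext i
    simp [shift, hp]
  rw [e]
  exact reduce_mem_cell y

/-- Composition with `reduce` is the periodic extension from the cell; it turns an `L²` class on the
cell back into an actual periodic function. -/
theorem aePeriodic_comp_reduce {d : ℕ} {E : Type*} (f : (Fin d → ℝ) → E) :
    AEPeriodic (fun y => f (reduce y)) := fun p => by
  simp [reduce_shift]

theorem comp_reduce_ae_eq {d : ℕ} {E : Type*} (f : (Fin d → ℝ) → E) :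
    (fun y => f (reduce y)) =ᵐ[cellMeasure d] f := by
  filter_upwards [ae_restrict_mem (measurableSet_cell d)] with y hy
  rw [reduce_of_mem_cell hy]

theorem memL2_comp_reduce {d : ℕ} {f : (Fin d → ℝ) → ℝ} (hf : MemLp f 2 (cellMeasure d)) :
    MemL2 (fun y => f (reduce y)) :=
  ⟨aePeriodic_comp_reduce f, (memLp_congr_ae (comp_reduce_ae_eq f)).2 hf⟩

/-! ### Periodic test functions -/

theorem memLp_cell_of_continuous {d : ℕ} {f : (Fin d → ℝ) → ℝ} (hf : Continuous f) (p : ℝ≥0∞) :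
    MemLp f p (cellMeasure d) := by
  obtain ⟨C, hC⟩ := (isCompact_Icc (a := fun _ : Fin d => (0 : ℝ))
    (b := fun _ => 2 * Real.pi)).exists_bound_of_continuousOn hf.continuousOn
  refine MemLp.of_bound hf.aestronglyMeasurable C ?_
  filter_upwards [ae_restrict_mem (measurableSet_cell d)] with y hy
  exact hC y ⟨fun i => (hy i trivial).1, fun i => (hy i trivial).2.le⟩

theorem IsTest.continuous {d : ℕ} {φ : (Fin d → ℝ) → ℝ} (hφ : IsTest φ) : Continuous φ :=
  hφ.1.continuous

theorem IsTest.differentiable {d : ℕ} {φ : (Fin d → ℝ) → ℝ} (hφ : IsTest φ) :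
    Differentiable ℝ φ :=
  hφ.1.differentiable (by simp)

theorem IsTest.mul {d : ℕ} {φ ψ : (Fin d → ℝ) → ℝ} (hφ : IsTest φ) (hψ : IsTest ψ) :
    IsTest (fun y => φ y * ψ y) :=
  ⟨hφ.1.mul hψ.1, fun p y => congrArg₂ (· * ·) (hφ.2 p y) (hψ.2 p y)⟩

theorem isTest_const (d : ℕ) (c : ℝ) : IsTest (fun _ : Fin d → ℝ => c) :=
  ⟨contDiff_const, fun _ _ => rfl⟩

theorem IsTest.fderiv_apply {d : ℕ} {φ : (Fin d → ℝ) → ℝ} (hφ : IsTest φ) (v : Fin d → ℝ) :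
    IsTest (fun y => fderiv ℝ φ y v) := by
  refine ⟨?_, fun p y => ?_⟩
  · exact (hφ.1.fderiv_right (m := ((⊤ : ℕ∞) : WithTop ℕ∞)) (by simp)).clm_apply contDiff_const
  · have h : (fun z => φ (z + fun i => 2 * Real.pi * (p i : ℝ))) = φ := by
      funext z
      exact hφ.2 p z
    have h2 := fderiv_comp_add_right (𝕜 := ℝ) (f := φ) (x := y) (fun i => 2 * Real.pi * (p i : ℝ))
    rw [h] at h2
    exact congrArg (fun L => L v) h2.symm

theorem IsTest.memL2 {d : ℕ} {φ : (Fin d → ℝ) → ℝ} (hφ : IsTest φ) : MemL2 φ :=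
  ⟨fun p => Eventually.of_forall (hφ.2 p), memLp_cell_of_continuous hφ.continuous 2⟩

/-- The integral of a partial derivative of a smooth periodic function vanishes. -/
theorem IsTest.integral_fderiv_eq_zero {d : ℕ} {φ : (Fin d → ℝ) → ℝ} (hφ : IsTest φ) (m : Fin d) :
    ∫ y in cell d, fderiv ℝ φ y (Pi.single m 1) = 0 := by
  obtain _ | n := d
  · exact m.elim0
  rw [setIntegral_congr_set (cell_ae_eq_Icc _)]
  have hle : (fun _ : Fin (n + 1) => (0 : ℝ)) ≤ fun _ => 2 * Real.pi :=
    fun _ => Real.two_pi_pos.le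
  have hs : ∀ y, (∑ i, (if i = m then fderiv ℝ φ else 0) y (Pi.single i 1 : Fin (n + 1) → ℝ))
      = fderiv ℝ φ y (Pi.single m 1) := by
    intro y
    rw [Finset.sum_eq_single m]
    · simp
    · intro i _ hi
      simp [hi]
    · simp
  -- Divergence theorem for the field whose only nonzero component is `φ`, in direction `m`.
  have h := integral_divergence_of_hasFDerivAt_off_countable'
    (fun _ : Fin (n + 1) => (0 : ℝ)) (fun _ => 2 * Real.pi) hle
    (fun i => if i = m then φ else 0) (fun i => if i = m then fderiv ℝ φ else 0) ∅
    Set.countable_empty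
    (fun i => by
      by_cases hi : i = m
      · simpa [hi] using hφ.continuous.continuousOn
      · simpa [hi] using! continuousOn_const (c := (0 : ℝ)))
    (fun x _ i => by
      by_cases hi : i = m
      · simpa [hi] using (hφ.differentiable x).hasFDerivAt
      · simpa [hi] using! hasFDerivAt_const (0 : ℝ) x)
    (by
      simp only [hs]
      exact (hφ.fderiv_apply _).continuous.continuousOn.integrableOn_compact isCompact_Icc)
  simp only [hs] at h
  rw [h]
  refine Finset.sum_eq_zero fun i _ => ?_
  by_cases hi : i = m
  · subst hi
    rw [sub_eq_zero]
    congr 1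
    funext x
    simp only [if_true]
    -- Opposite faces differ by one period in direction `i`, so their contributions cancel.
    rw [← hφ.2 (Pi.single i 1) (i.insertNth 0 x)]
    congr 1
    funext j
    refine Fin.succAboveCases i ?_ (fun j => ?_) j
    · simp [shift]
    · simp [shift, Fin.succAbove_ne]
  · simp [hi]

theorem IsTest.integral_mul_fderiv {d : ℕ} {φ ψ : (Fin d → ℝ) → ℝ} (hφ : IsTest φ) (hψ : IsTest ψ)
    (m : Fin d) :
    ∫ y in cell d, φ y * fderiv ℝ ψ y (Pi.single m 1) =
      - ∫ y in cell d, fderiv ℝ φ y (Pi.single m 1) * ψ y := by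
  have h := (hφ.mul hψ).integral_fderiv_eq_zero m
  have e : ∀ y, fderiv ℝ (fun y => φ y * ψ y) y (Pi.single m 1) =
      φ y * fderiv ℝ ψ y (Pi.single m 1) + fderiv ℝ φ y (Pi.single m 1) * ψ y := by
    intro y
    rw [fderiv_fun_mul (hφ.differentiable y) (hψ.differentiable y)]
    simp [mul_comm]
  simp only [e] at h
  rw [integral_add] at h
  · linarith
  · exact (memLp_cell_of_continuous (hφ.mul (hψ.fderiv_apply _)).continuous 1).integrable le_rfl
  · exact (memLp_cell_of_continuous ((hφ.fderiv_apply _).mul hψ).continuous 1).integrable le_rfl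

/-! ### Plane waves -/

/-- The real plane wave `cos (k · y + s)`. -/
noncomputable def wave {d : ℕ} (k : Fin d → ℤ) (s : ℝ) (y : Fin d → ℝ) : ℝ :=
  Real.cos ((∑ i, (k i : ℝ) * y i) + s)

theorem wave_add_pi {d : ℕ} (k : Fin d → ℤ) (s : ℝ) (y : Fin d → ℝ) :
    wave k (s + Real.pi) y = - wave k s y := by
  simp [wave, ← add_assoc, Real.cos_add_pi]

theorem isTest_wave {d : ℕ} (k : Fin d → ℤ) (s : ℝ) : IsTest (wave k s) := by
  refine ⟨?_, fun p y => ?_⟩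
  · unfold wave
    fun_prop
  · have h : (∑ i, (k i : ℝ) * shift p y i) + s =
        ((∑ i, (k i : ℝ) * y i) + s) + ((∑ i, k i * p i : ℤ) : ℝ) * (2 * Real.pi) := by
      push_cast
      rw [Finset.sum_mul, add_right_comm, ← Finset.sum_add_distrib]
      congr 1
      refine Finset.sum_congr rfl fun i _ => ?_
      simp only [shift]
      ring
    rw [wave, h, Real.cos_add_int_mul_two_pi, wave]

/-- Differentiating a cosine advances its phase by `π / 2`. Keeping the phase as a parameter makes
the family of waves closed under derivatives up to a factor. -/
theorem fderiv_wave {d : ℕ} (k : Fin d → ℤ) (s : ℝ) (m : Fin d) (y : Fin d → ℝ) :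
    fderiv ℝ (wave k s) y (Pi.single m 1) = (k m : ℝ) * wave k (s + Real.pi / 2) y := by
  have h1 : HasFDerivAt (fun y : Fin d → ℝ => (∑ i, (k i : ℝ) * y i) + s)
      (∑ i, (k i : ℝ) • ContinuousLinearMap.proj (R := ℝ) (φ := fun _ : Fin d => ℝ) i) y := by
    refine HasFDerivAt.add_const _ (HasFDerivAt.fun_sum fun i _ => ?_)
    exact (ContinuousLinearMap.proj (R := ℝ) (φ := fun _ : Fin d => ℝ) i).hasFDerivAt.const_mul _
  have h2 : HasFDerivAt (wave k s) _ y := h1.cos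
  rw [h2.fderiv]
  simp [wave, Pi.single_apply, ← add_assoc, Real.cos_add_pi_div_two]
  ring

/-! ### Parseval's identity on the periodicity cell -/

section Parseval

attribute [local instance] instMeasureSpaceUnitAddCircle

/-- The section of the quotient map from the periodicity cell to the unit torus. -/
noncomputable def torusSection {d : ℕ} (t : UnitAddTorus (Fin d)) : Fin d → ℝ :=
  (2 * Real.pi) • (UnitAddTorus.measurableEquivPiIoc (fun _ : Fin d => (0 : ℝ)) t).1

/-- The normalisation constant of the cell measure. -/
noncomputable def cellWeight (d : ℕ) : ℝ≥0∞ := ENNReal.ofReal |((2 * Real.pi) ^ d)⁻¹|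

theorem toReal_cellWeight (d : ℕ) : (cellWeight d).toReal = ((2 * Real.pi) ^ d)⁻¹ := by
  rw [cellWeight, ENNReal.toReal_ofReal (abs_nonneg _), abs_of_pos]
  have := Real.two_pi_pos
  positivity

/-- Dilation by `2π` scales Lebesgue measure by a power of `2π`, recorded in `cellWeight`; the two
half-open versions of the cell agree up to a null set. -/
theorem measurePreserving_torusSection (d : ℕ) :
    MeasurePreserving (torusSection (d := d)) volume (cellWeight d • cellMeasure d) := by
  have h1 := UnitAddTorus.measurePreserving_equivPiIoc (fun _ : Fin d => (0 : ℝ))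
  have h2 := measurePreserving_subtype_coe (μa := (volume : Measure (Fin d → ℝ)))
    (s := {x | ∀ i, x i ∈ Set.Ioc (0 : ℝ) (0 + 1)})
    (MeasurableSet.univ_pi' fun _ => measurableSet_Ioc)
  have h3 : MeasurePreserving (fun x : Fin d → ℝ => (2 * Real.pi) • x) volume
      (cellWeight d • volume) := by
    refine ⟨measurable_const_smul _, ?_⟩
    rw [Measure.map_addHaar_smul _ Real.two_pi_pos.ne']
    simp [cellWeight]
  have hm : MeasurableSet (Set.pi Set.univ (fun _ : Fin d => Set.Ioc (0 : ℝ) (2 * Real.pi))) :=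
    MeasurableSet.univ_pi fun _ => measurableSet_Ioc
  have h4 := h3.restrict_preimage hm
  have e1 : (fun x : Fin d → ℝ => (2 * Real.pi) • x) ⁻¹'
      (Set.pi Set.univ (fun _ : Fin d => Set.Ioc (0 : ℝ) (2 * Real.pi))) =
      {x | ∀ i, x i ∈ Set.Ioc (0 : ℝ) (0 + 1)} := by
    ext x
    have hp := Real.two_pi_pos
    simp only [Set.mem_preimage, Set.mem_pi, Set.mem_univ, true_imp_iff, Pi.smul_apply,
      smul_eq_mul, Set.mem_Ioc, Set.mem_ofPred_eq, zero_add]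
    refine forall_congr' fun i => and_congr (mul_pos_iff_of_pos_left hp) ?_
    exact mul_le_iff_le_one_right hp
  rw [e1, Measure.restrict_smul, ← Measure.restrict_congr_set (cell_ae_eq_Ioc d)] at h4
  exact h4.comp (h2.comp h1)

/-- The phase `π / 2` produces minus the sine, so a complex Fourier coefficient of a real function
splits into two real integrals against waves. -/
theorem mFourier_neg_eq_wave {d : ℕ} (k : Fin d → ℤ) (t : UnitAddTorus (Fin d)) :
    UnitAddTorus.mFourier (-k) t = (wave k 0 (torusSection t) : ℂ) +
      Complex.I * (wave k (Real.pi / 2) (torusSection t) : ℂ) := by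
  obtain ⟨x, hx⟩ : ∃ x : Fin d → ℝ, x = (UnitAddTorus.measurableEquivPiIoc (fun _ => 0) t).1 :=
    ⟨_, rfl⟩
  have ht : t = fun i => (x i : UnitAddCircle) := by
    have := (UnitAddTorus.measurableEquivPiIoc (fun _ : Fin d => (0 : ℝ))).symm_apply_apply t
    rw [UnitAddTorus.coe_symm_measurableEquivPiIoc_apply] at this
    rw [hx]
    exact this.symm
  have hS : torusSection t = (2 * Real.pi) • x := by rw [hx]; rfl
  rw [hS, ht]
  have e : (∑ i, (k i : ℝ) * ((2 * Real.pi) • x) i) = 2 * Real.pi * ∑ i, k i * x i := by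
    rw [Finset.mul_sum]
    refine Finset.sum_congr rfl fun i _ => ?_
    simp
    ring
  have hF : UnitAddTorus.mFourier (-k) (fun i => (x i : UnitAddCircle)) =
      Complex.exp (((-(2 * Real.pi * ∑ i, k i * x i) : ℝ) : ℂ) * Complex.I) := by
    simp only [UnitAddTorus.mFourier, ContinuousMap.coe_mk, fourier_coe_apply,
      ← Complex.exp_sum]
    congr 1
    push_cast
    rw [Finset.mul_sum, ← Finset.sum_neg_distrib, Finset.sum_mul]
    refine Finset.sum_congr rfl fun i _ => ?_
    simp
    ring
  rw [hF, Complex.exp_mul_I, wave, wave, e, add_zero, Real.cos_add_pi_div_two,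
    ← Complex.ofReal_cos, ← Complex.ofReal_sin, Real.cos_neg, Real.sin_neg]
  push_cast
  ring

/-- The energy of the `k`-th Fourier mode of `u`. -/
noncomputable def modeEnergy {d : ℕ} (k : Fin d → ℤ) (u : (Fin d → ℝ) → ℝ) : ℝ :=
  (∫ y in cell d, wave k 0 y * u y) ^ 2 + (∫ y in cell d, wave k (Real.pi / 2) y * u y) ^ 2

/-- **Parseval's identity** for real periodic functions. -/
theorem hasSum_modeEnergy {d : ℕ} {u : (Fin d → ℝ) → ℝ} (hu : MemLp u 2 (cellMeasure d)) :
    HasSum (fun k => modeEnergy k u) ((2 * Real.pi) ^ d * ∫ y in cell d, u y ^ 2) := by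
  have hS := measurePreserving_torusSection d
  have hc0 : cellWeight d ≠ ⊤ := ENNReal.ofReal_ne_top
  have hpos : (0 : ℝ) < (2 * Real.pi) ^ d := pow_pos Real.two_pi_pos d
  have huS : MemLp (fun t => u (torusSection t)) 2 (volume : Measure (UnitAddTorus (Fin d))) :=
    (hu.smul_measure hc0).comp_measurePreserving hS
  have hint : ∀ {g : (Fin d → ℝ) → ℝ}, AEStronglyMeasurable g (cellMeasure d) →
      ∫ t, g (torusSection t) = ((2 * Real.pi) ^ d)⁻¹ * ∫ y in cell d, g y := by
    intro g hg
    rw [← integral_map (φ := torusSection) hS.measurable.aemeasurable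
      (by rw [hS.map_eq]; exact hg.smul_measure _), hS.map_eq, integral_smul_measure,
      toReal_cellWeight, smul_eq_mul]
  have hw : ∀ k s, MemLp (fun y => wave k s y * u y) 1 (cellMeasure d) := fun k s =>
    hu.mul (memLp_cell_of_continuous (isTest_wave k s).continuous 2)
  have hwS : ∀ k s, Integrable (fun t => wave k s (torusSection t) * u (torusSection t))
      (volume : Measure (UnitAddTorus (Fin d))) := fun k s =>
    memLp_one_iff_integrable.1 (((hw k s).smul_measure hc0).comp_measurePreserving hS)
  have hF := huS.ofReal (K := ℂ)
  have key := UnitAddTorus.hasSum_sq_mFourierCoeff (hF.toLp _)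
  have hnorm : (∫ t, ‖(hF.toLp _ : UnitAddTorus (Fin d) → ℂ) t‖ ^ 2) =
      ((2 * Real.pi) ^ d)⁻¹ * ∫ y in cell d, u y ^ 2 := by
    rw [← hint (g := fun y => u y ^ 2) (hu.aestronglyMeasurable.pow 2)]
    refine integral_congr_ae ?_
    filter_upwards [hF.coeFn_toLp] with t ht
    rw [ht]
    simp
  have hcoef : ∀ k, ‖UnitAddTorus.mFourierCoeff (hF.toLp _ : UnitAddTorus (Fin d) → ℂ) k‖ ^ 2 =
      (((2 * Real.pi) ^ d)⁻¹) ^ 2 * modeEnergy k u := by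
    intro k
    have e1 : UnitAddTorus.mFourierCoeff (hF.toLp _ : UnitAddTorus (Fin d) → ℂ) k =
        ∫ t, (((wave k 0 (torusSection t) * u (torusSection t) : ℝ) : ℂ) +
          Complex.I * ((wave k (Real.pi / 2) (torusSection t) * u (torusSection t) : ℝ) : ℂ)) := by
      refine integral_congr_ae ?_
      filter_upwards [hF.coeFn_toLp] with t ht
      rw [ht, mFourier_neg_eq_wave]
      simp
      ring
    rw [integral_add (hwS k 0).ofReal ((hwS k _).ofReal.const_mul _), integral_const_mul,
      integral_complex_ofReal, integral_complex_ofReal,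
      hint (g := fun y => wave k 0 y * u y) (hw k 0).1,
      hint (g := fun y => wave k (Real.pi / 2) y * u y) (hw k _).1] at e1
    rw [e1, mul_comm Complex.I, ← Complex.normSq_eq_norm_sq, Complex.normSq_add_mul_I, modeEnergy]
    ring
  rw [hnorm] at key
  simp only [hcoef] at key
  have e1 : ∀ k, ((2 * Real.pi) ^ d) ^ 2 * ((((2 * Real.pi) ^ d)⁻¹) ^ 2 * modeEnergy k u) =
      modeEnergy k u := fun k => by field_simp
  have e2 : ((2 * Real.pi) ^ d) ^ 2 * (((2 * Real.pi) ^ d)⁻¹ * ∫ y in cell d, u y ^ 2) =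
      (2 * Real.pi) ^ d * ∫ y in cell d, u y ^ 2 := by field_simp
  have := key.mul_left (((2 * Real.pi) ^ d) ^ 2)
  simp only [e1] at this
  rwa [e2] at this

end Parseval

/-! ### Sobolev spaces of periodic functions as Hilbert spaces -/

/-- The Hilbert space of square integrable functions on the periodicity cell. -/
noncomputable abbrev L2Cell (d : ℕ) : Type := Lp ℝ 2 (cellMeasure d)

/-- The class of a test function. -/
noncomputable def IsTest.toL2 {d : ℕ} {φ : (Fin d → ℝ) → ℝ} (hφ : IsTest φ) : L2Cell d :=
  hφ.memL2.2.toLp φ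

theorem L2Cell.inner_toLp_left {d : ℕ} {φ : (Fin d → ℝ) → ℝ} (hφ : MemLp φ 2 (cellMeasure d))
    (U : L2Cell d) : inner ℝ (hφ.toLp φ) U = ∫ y in cell d, φ y * U y := by
  rw [L2.inner_def]
  refine integral_congr_ae ?_
  filter_upwards [hφ.coeFn_toLp] with y hy
  rw [hy]
  simp [mul_comm]

theorem IsTest.inner_toL2 {d : ℕ} {φ : (Fin d → ℝ) → ℝ} (hφ : IsTest φ) (U : L2Cell d) :
    inner ℝ hφ.toL2 U = ∫ y in cell d, φ y * U y :=
  L2Cell.inner_toLp_left hφ.memL2.2 U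

theorem modeEnergy_eq {d : ℕ} (k : Fin d → ℤ) (U : L2Cell d) :
    modeEnergy k U = inner ℝ (isTest_wave k 0).toL2 U ^ 2 +
      inner ℝ (isTest_wave k (Real.pi / 2)).toL2 U ^ 2 := by
  rw [IsTest.inner_toL2, IsTest.inner_toL2, modeEnergy]

theorem modeEnergy_nonneg {d : ℕ} (k : Fin d → ℤ) (u : (Fin d → ℝ) → ℝ) : 0 ≤ modeEnergy k u := by
  unfold modeEnergy
  positivity

theorem L2Cell.hasSum_modeEnergy {d : ℕ} (U : L2Cell d) :
    HasSum (fun k => modeEnergy k U) ((2 * Real.pi) ^ d * ‖U‖ ^ 2) := by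
  have h : ‖U‖ ^ 2 = ∫ y in cell d, U y ^ 2 := by
    rw [← real_inner_self_eq_norm_sq, L2.inner_def]
    simp [sq]
  rw [h]
  exact PeriodicHom.hasSum_modeEnergy (Lp.memLp U)

/-- Parseval lets norm inequalities be checked one frequency at a time; the Sobolev estimates below
all pass through this. -/
theorem L2Cell.norm_sq_le_sum {d : ℕ} {ι : Type*} (s : Finset ι) {U : L2Cell d} {W : ι → L2Cell d}
    (h : ∀ k, modeEnergy k U ≤ ∑ i ∈ s, modeEnergy k (W i)) : ‖U‖ ^ 2 ≤ ∑ i ∈ s, ‖W i‖ ^ 2 := by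
  have h1 := hasSum_le h U.hasSum_modeEnergy (hasSum_sum fun i _ => (W i).hasSum_modeEnergy)
  rw [← Finset.mul_sum] at h1
  exact le_of_mul_le_mul_left h1 (pow_pos Real.two_pi_pos d)

theorem L2Cell.norm_sq_le {d : ℕ} {U W : L2Cell d}
    (h : ∀ k, modeEnergy k U ≤ modeEnergy k W) : ‖U‖ ^ 2 ≤ ‖W‖ ^ 2 := by
  simpa using L2Cell.norm_sq_le_sum {()} (W := fun _ => W) (by simpa using h)

theorem L2Cell.eq_zero_of_modeEnergy {d : ℕ} {U : L2Cell d}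
    (h : ∀ k, modeEnergy k U = 0) : U = 0 := by
  have := L2Cell.norm_sq_le_sum (∅ : Finset Unit) (U := U) (W := fun _ => 0) (by simp [h])
  simp only [Finset.sum_empty] at this
  exact norm_eq_zero.1 (pow_eq_zero_iff two_ne_zero |>.1 (le_antisymm this (sq_nonneg _)))

/-- `U` has mean zero. -/
def MeanZero {d : ℕ} (U : L2Cell d) : Prop := inner ℝ (isTest_const d 1).toL2 U = 0

theorem MeanZero.modeEnergy_zero {d : ℕ} {U : L2Cell d} (h : MeanZero U) :
    modeEnergy (0 : Fin d → ℤ) U = 0 := by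
  rw [MeanZero, IsTest.inner_toL2] at h
  simp only [one_mul] at h
  simp [modeEnergy, wave, h]

/-- `G` is the weak partial derivative of `U` in direction `m`. -/
def HasWeakPartial {d : ℕ} (m : Fin d) (U G : L2Cell d) : Prop :=
  ∀ (φ : (Fin d → ℝ) → ℝ) (hφ : IsTest φ),
    inner ℝ (hφ.fderiv_apply (Pi.single m 1)).toL2 U + inner ℝ hφ.toL2 G = 0

/-! ### Weak derivatives on the Fourier side -/

namespace HasWeakPartial

variable {d : ℕ} {m : Fin d} {U U' G G' : L2Cell d}

theorem zero : HasWeakPartial m (0 : L2Cell d) 0 := fun φ hφ => by simp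

theorem add (h : HasWeakPartial m U G) (h' : HasWeakPartial m U' G') :
    HasWeakPartial m (U + U') (G + G') := fun φ hφ => by
  rw [inner_add_right, inner_add_right]
  linear_combination h φ hφ + h' φ hφ

theorem smul (c : ℝ) (h : HasWeakPartial m U G) : HasWeakPartial m (c • U) (c • G) :=
  fun φ hφ => by
    rw [inner_smul_right, inner_smul_right]
    linear_combination c * h φ hφ

theorem inner_wave (h : HasWeakPartial m U G) (k : Fin d → ℤ) (s : ℝ) :
    inner ℝ (isTest_wave k s).toL2 G =
      - (k m * inner ℝ (isTest_wave k (s + Real.pi / 2)).toL2 U) := by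
  have h1 := h _ (isTest_wave k s)
  have h2 : inner ℝ ((isTest_wave k s).fderiv_apply (Pi.single m 1)).toL2 U =
      k m * inner ℝ (isTest_wave k (s + Real.pi / 2)).toL2 U := by
    rw [IsTest.inner_toL2, IsTest.inner_toL2, ← integral_const_mul]
    simp only [fderiv_wave, mul_assoc]
  linarith

theorem inner_wave_zero (h : HasWeakPartial m U G) (k : Fin d → ℤ) :
    inner ℝ (isTest_wave k 0).toL2 G =
      - (k m * inner ℝ (isTest_wave k (Real.pi / 2)).toL2 U) := by
  rw [h.inner_wave, IsTest.inner_toL2, IsTest.inner_toL2, zero_add]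

theorem inner_wave_pi_div_two (h : HasWeakPartial m U G) (k : Fin d → ℤ) :
    inner ℝ (isTest_wave k (Real.pi / 2)).toL2 G =
      k m * inner ℝ (isTest_wave k 0).toL2 U := by
  rw [h.inner_wave, IsTest.inner_toL2, IsTest.inner_toL2]
  have e : Real.pi / 2 + Real.pi / 2 = 0 + Real.pi := by ring
  simp only [e, wave_add_pi, neg_mul, integral_neg, mul_neg, neg_neg]

/-- On a fixed frequency, differentiation is a quarter turn between the two phases followed by
multiplication by `k m`. -/
theorem modeEnergy_eq (h : HasWeakPartial m U G) (k : Fin d → ℤ) :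
    modeEnergy k G = (k m : ℝ) ^ 2 * modeEnergy k U := by
  rw [PeriodicHom.modeEnergy_eq, PeriodicHom.modeEnergy_eq, h.inner_wave_zero,
    h.inner_wave_pi_div_two]
  ring

/-- The difference is a weak derivative of `0`, so all its mode energies vanish; Parseval stands in
for the density of test functions. -/
theorem unique (h : HasWeakPartial m U G) (h' : HasWeakPartial m U G') : G = G' := by
  have h1 := h.add (h'.smul (-1))
  rw [← sub_eq_zero]
  refine L2Cell.eq_zero_of_modeEnergy fun k => ?_
  have h2 := h1.modeEnergy_eq k
  have e : U + (-1 : ℝ) • U = 0 := by simp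
  have e' : G + (-1 : ℝ) • G' = G - G' := by simp [sub_eq_add_neg]
  rw [e, e'] at h2
  rw [h2, PeriodicHom.modeEnergy_eq]
  simp

end HasWeakPartial

theorem isClosed_hasWeakPartial {d : ℕ} (m : Fin d) {X : Type*} [TopologicalSpace X]
    {u g : X → L2Cell d} (hu : Continuous u) (hg : Continuous g) :
    IsClosed {x | HasWeakPartial m (u x) (g x)} := by
  simp only [HasWeakPartial, Set.ofPred_forall]
  exact isClosed_iInter fun φ => isClosed_iInter fun hφ =>
    isClosed_eq (by fun_prop) continuous_const

theorem isClosed_meanZero {d : ℕ} {X : Type*} [TopologicalSpace X]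
    {u : X → L2Cell d} (hu : Continuous u) : IsClosed {x | MeanZero (u x)} :=
  isClosed_eq (by fun_prop) continuous_const

theorem IsTest.hasWeakPartial {d : ℕ} {φ : (Fin d → ℝ) → ℝ} (hφ : IsTest φ) (m : Fin d) :
    HasWeakPartial m hφ.toL2 (hφ.fderiv_apply (Pi.single m 1)).toL2 := by
  intro ψ hψ
  have h := hφ.integral_mul_fderiv hψ m
  have e1 : inner ℝ (hψ.fderiv_apply (Pi.single m 1)).toL2 hφ.toL2 =
      ∫ y in cell d, φ y * fderiv ℝ ψ y (Pi.single m 1) := by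
    rw [real_inner_comm, IsTest.inner_toL2]
    refine integral_congr_ae ?_
    filter_upwards [(hψ.fderiv_apply (Pi.single m 1)).memL2.2.coeFn_toLp] with y hy
    rw [IsTest.toL2, hy]
  have e2 : inner ℝ hψ.toL2 (hφ.fderiv_apply (Pi.single m 1)).toL2 =
      ∫ y in cell d, fderiv ℝ φ y (Pi.single m 1) * ψ y := by
    rw [IsTest.inner_toL2]
    refine integral_congr_ae ?_
    filter_upwards [(hφ.fderiv_apply (Pi.single m 1)).memL2.2.coeFn_toLp] with y hy
    rw [IsTest.toL2, hy, mul_comm]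
  rw [e1, e2, h]
  ring

/-- Square integrable vector fields on the cell. -/
noncomputable abbrev L2Field (d : ℕ) : Type := PiLp 2 (fun _ : Fin d => L2Cell d)

/-- The mean-zero space `H¹` as a space of functions together with their gradients. -/
noncomputable def sobolev1 (d : ℕ) :
    Submodule ℝ (PiLp 2 (fun _ : Option (Fin d) => L2Cell d)) where
  carrier := {x | MeanZero (x none) ∧ ∀ m, HasWeakPartial m (x none) (x (some m))}
  zero_mem' := ⟨by simp [MeanZero], fun m => HasWeakPartial.zero⟩
  add_mem' := fun {x y} hx hy => ⟨by
    have h1 := hx.1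
    have h2 := hy.1
    simp only [MeanZero] at h1 h2 ⊢
    simp [inner_add_right, h1, h2], fun m => (hx.2 m).add (hy.2 m)⟩
  smul_mem' := fun c x hx => ⟨by
    have h1 := hx.1
    simp only [MeanZero] at h1 ⊢
    simp [inner_smul_right, h1], fun m => (hx.2 m).smul c⟩

/-- The mean-zero space `H²` as a space of functions together with their first and second
derivatives. -/
noncomputable def sobolev2 (d : ℕ) :
    Submodule ℝ (PiLp 2 (fun _ : Option (Fin d) ⊕ Fin d × Fin d => L2Cell d)) where
  carrier := {x | MeanZero (x (.inl none)) ∧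
    (∀ m, HasWeakPartial m (x (.inl none)) (x (.inl (some m)))) ∧
    ∀ m n, HasWeakPartial n (x (.inl (some m))) (x (.inr (m, n)))}
  zero_mem' := ⟨by simp [MeanZero], fun m => HasWeakPartial.zero, fun m n => HasWeakPartial.zero⟩
  add_mem' := fun {x y} hx hy => ⟨by
    have h1 := hx.1
    have h2 := hy.1
    simp only [MeanZero] at h1 h2 ⊢
    simp [inner_add_right, h1, h2], fun m => (hx.2.1 m).add (hy.2.1 m),
    fun m n => (hx.2.2 m n).add (hy.2.2 m n)⟩
  smul_mem' := fun c x hx => ⟨by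
    have h1 := hx.1
    simp only [MeanZero] at h1 ⊢
    simp [inner_smul_right, h1], fun m => (hx.2.1 m).smul c, fun m n => (hx.2.2 m n).smul c⟩

/-- Membership is a family of equations between continuous inner products. Closedness supplies the
completeness needed for Lax–Milgram. -/
theorem isClosed_sobolev1 (d : ℕ) :
    IsClosed (sobolev1 d : Set (PiLp 2 fun _ : Option (Fin d) => L2Cell d)) := by
  have e : (sobolev1 d : Set (PiLp 2 fun _ : Option (Fin d) => L2Cell d)) =
      {x | MeanZero (x none)} ∩ ⋂ m, {x | HasWeakPartial m (x none) (x (some m))} := by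
    ext x
    simp [sobolev1]
  rw [e]
  exact (isClosed_meanZero (by fun_prop)).inter
    (isClosed_iInter fun m => isClosed_hasWeakPartial m (by fun_prop) (by fun_prop))

theorem isClosed_sobolev2 (d : ℕ) : IsClosed
    (sobolev2 d : Set (PiLp 2 fun _ : Option (Fin d) ⊕ Fin d × Fin d => L2Cell d)) := by
  have e : (sobolev2 d : Set (PiLp 2 fun _ : Option (Fin d) ⊕ Fin d × Fin d => L2Cell d)) =
      {x | MeanZero (x (.inl none))} ∩
      ((⋂ m, {x | HasWeakPartial m (x (.inl none)) (x (.inl (some m)))}) ∩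
      ⋂ m, ⋂ n, {x | HasWeakPartial n (x (.inl (some m))) (x (.inr (m, n)))}) := by
    ext x
    simp [sobolev2]
  rw [e]
  exact (isClosed_meanZero (by fun_prop)).inter
    ((isClosed_iInter fun m => isClosed_hasWeakPartial m (by fun_prop) (by fun_prop)).inter
    (isClosed_iInter fun m => isClosed_iInter fun n =>
      isClosed_hasWeakPartial n (by fun_prop) (by fun_prop)))

instance (d : ℕ) : CompleteSpace (sobolev1 d) := (isClosed_sobolev1 d).completeSpace_coe

instance (d : ℕ) : CompleteSpace (sobolev2 d) := (isClosed_sobolev2 d).completeSpace_coe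

/-- The gradient on `H¹`. -/
noncomputable def grad1 (d : ℕ) : sobolev1 d →L[ℝ] L2Field d :=
  ((PiLp.continuousLinearEquiv 2 ℝ (fun _ : Fin d => L2Cell d)).symm :
    (Fin d → L2Cell d) →L[ℝ] L2Field d) ∘L
  (ContinuousLinearMap.pi fun m => PiLp.proj 2 (fun _ : Option (Fin d) => L2Cell d) (some m)) ∘L
  (sobolev1 d).subtypeL

/-- The gradient on `H²`. -/
noncomputable def grad2 (d : ℕ) : sobolev2 d →L[ℝ] L2Field d :=
  ((PiLp.continuousLinearEquiv 2 ℝ (fun _ : Fin d => L2Cell d)).symm :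
    (Fin d → L2Cell d) →L[ℝ] L2Field d) ∘L
  (ContinuousLinearMap.pi fun m =>
    PiLp.proj 2 (fun _ : Option (Fin d) ⊕ Fin d × Fin d => L2Cell d) (.inl (some m))) ∘L
  (sobolev2 d).subtypeL

/-- The Laplacian on `H²`. -/
noncomputable def laplacian2 (d : ℕ) : sobolev2 d →L[ℝ] L2Cell d :=
  (∑ m, PiLp.proj 2 (fun _ : Option (Fin d) ⊕ Fin d × Fin d => L2Cell d) (.inr (m, m))) ∘L
  (sobolev2 d).subtypeL

theorem grad1_apply {d : ℕ} (x : sobolev1 d) (m : Fin d) : grad1 d x m = x.1 (some m) := rfl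

theorem laplacian2_apply {d : ℕ} (x : sobolev2 d) :
    laplacian2 d x = ∑ m, x.1 (.inr (m, m)) := by
  simp [laplacian2]

/-! ### Poincaré and elliptic estimates -/

theorem one_le_sum_sq {d : ℕ} {k : Fin d → ℤ} (hk : k ≠ 0) : (1 : ℝ) ≤ ∑ m, (k m : ℝ) ^ 2 := by
  obtain ⟨i, hi⟩ := Function.ne_iff.1 hk
  have hi' : k i ≠ 0 := hi
  have h1 : (0 : ℤ) < (k i) ^ 2 := by positivity
  -- Integrality upgrades positivity to a lower bound by one: this is the spectral gap.
  replace h1 : (1 : ℤ) ≤ (k i) ^ 2 := h1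
  calc (1 : ℝ) ≤ (k i : ℝ) ^ 2 := by exact_mod_cast h1
    _ ≤ _ := Finset.single_le_sum (f := fun m => (k m : ℝ) ^ 2) (fun m _ => sq_nonneg _)
      (Finset.mem_univ i)

/-- **Poincaré's inequality** on `H¹`. -/
theorem norm_sq_le_grad1 {d : ℕ} (x : sobolev1 d) : ‖x‖ ^ 2 ≤ 2 * ‖grad1 d x‖ ^ 2 := by
  have h1 : ‖x.1 none‖ ^ 2 ≤ ∑ m, ‖x.1 (some m)‖ ^ 2 := by
    refine L2Cell.norm_sq_le_sum Finset.univ fun k => ?_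
    simp only [fun m => (x.2.2 m).modeEnergy_eq k]
    rcases eq_or_ne k 0 with rfl | hk
    · simp [x.2.1.modeEnergy_zero]
    · rw [← Finset.sum_mul]
      exact le_mul_of_one_le_left (modeEnergy_nonneg _ _) (one_le_sum_sq hk)
  -- The factor 2 arises because the norm of `x` contains both the function and its gradient.
  rw [Submodule.coe_norm, PiLp.norm_sq_eq_of_L2, PiLp.norm_sq_eq_of_L2, Fintype.sum_option]
  simp only [grad1_apply]
  linarith

/-- Two quarter turns give a sign, so each pure second derivative acts on both phases as `-(k m)²`.
These multipliers add up before squaring, which produces `|k|⁴`. -/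
theorem modeEnergy_laplacian2 {d : ℕ} (x : sobolev2 d) (k : Fin d → ℤ) :
    modeEnergy k (laplacian2 d x) =
      (∑ m, (k m : ℝ) ^ 2) ^ 2 * modeEnergy k (x.1 (.inl none)) := by
  have h0 : ∀ m, inner ℝ (isTest_wave k 0).toL2 (x.1 (.inr (m, m))) =
      - ((k m : ℝ) ^ 2 * inner ℝ (isTest_wave k 0).toL2 (x.1 (.inl none))) := fun m => by
    rw [(x.2.2.2 m m).inner_wave_zero, (x.2.2.1 m).inner_wave_pi_div_two]
    ring
  have h1 : ∀ m, inner ℝ (isTest_wave k (Real.pi / 2)).toL2 (x.1 (.inr (m, m))) =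
      - ((k m : ℝ) ^ 2 * inner ℝ (isTest_wave k (Real.pi / 2)).toL2 (x.1 (.inl none))) :=
    fun m => by
      rw [(x.2.2.2 m m).inner_wave_pi_div_two, (x.2.2.1 m).inner_wave_zero]
      ring
  rw [modeEnergy_eq, modeEnergy_eq, laplacian2_apply, inner_sum, inner_sum]
  simp only [h0, h1, Finset.sum_neg_distrib, ← Finset.sum_mul]
  ring

/-- The elliptic estimate on `H²`. -/
theorem norm_sq_le_laplacian2 {d : ℕ} (x : sobolev2 d) :
    ‖x‖ ^ 2 ≤ (1 + d + d * d) * ‖laplacian2 d x‖ ^ 2 := by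
  have key : ∀ k : Fin d → ℤ, k ≠ 0 → ∀ c : ℝ, c ≤ (∑ m, (k m : ℝ) ^ 2) ^ 2 →
      c * modeEnergy k (x.1 (.inl none)) ≤ modeEnergy k (laplacian2 d x) := by
    intro k _ c hc
    rw [modeEnergy_laplacian2]
    exact mul_le_mul_of_nonneg_right hc (modeEnergy_nonneg _ _)
  have hs : ∀ (k : Fin d → ℤ) m, (k m : ℝ) ^ 2 ≤ ∑ m, (k m : ℝ) ^ 2 := fun k m =>
    Finset.single_le_sum (f := fun m => (k m : ℝ) ^ 2) (fun m _ => sq_nonneg _)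
      (Finset.mem_univ m)
  have h0 : ‖x.1 (.inl none)‖ ^ 2 ≤ ‖laplacian2 d x‖ ^ 2 := by
    refine L2Cell.norm_sq_le fun k => ?_
    rcases eq_or_ne k 0 with rfl | hk
    · rw [x.2.1.modeEnergy_zero]
      exact modeEnergy_nonneg _ _
    · simpa using key k hk 1 (one_le_pow₀ (one_le_sum_sq hk))
  have h1 : ∀ m, ‖x.1 (.inl (some m))‖ ^ 2 ≤ ‖laplacian2 d x‖ ^ 2 := by
    refine fun m => L2Cell.norm_sq_le fun k => ?_
    rw [(x.2.2.1 m).modeEnergy_eq]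
    rcases eq_or_ne k 0 with rfl | hk
    · rw [x.2.1.modeEnergy_zero, mul_zero]
      exact modeEnergy_nonneg _ _
    · exact key k hk _ ((hs k m).trans (le_self_pow₀ (one_le_sum_sq hk) two_ne_zero))
  have h2 : ∀ q : Fin d × Fin d, ‖x.1 (.inr q)‖ ^ 2 ≤ ‖laplacian2 d x‖ ^ 2 := by
    rintro ⟨m, n⟩
    refine L2Cell.norm_sq_le fun k => ?_
    rw [(x.2.2.2 m n).modeEnergy_eq, (x.2.2.1 m).modeEnergy_eq, ← mul_assoc]
    rcases eq_or_ne k 0 with rfl | hk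
    · rw [x.2.1.modeEnergy_zero, mul_zero]
      exact modeEnergy_nonneg _ _
    · refine key k hk _ ?_
      rw [sq (∑ m, (k m : ℝ) ^ 2)]
      exact mul_le_mul (hs k n) (hs k m) (sq_nonneg _)
        (zero_le_one.trans (one_le_sum_sq hk))
  -- The constant `1 + d + d * d` counts the components of `x`, each bounded by the Laplacian.
  rw [Submodule.coe_norm, PiLp.norm_sq_eq_of_L2, Fintype.sum_sum_type, Fintype.sum_option]
  have h3 := Finset.sum_le_sum fun m (_ : m ∈ Finset.univ) => h1 m
  have h4 := Finset.sum_le_sum fun q (_ : q ∈ Finset.univ) => h2 q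
  simp only [Finset.sum_const, Finset.card_univ, Fintype.card_prod, Fintype.card_fin,
    nsmul_eq_mul, Nat.cast_mul] at h3 h4
  linarith

/-! ### Density of `H²` gradients -/

/-- The inclusion of `H²` into `H¹` is compatible with gradients. -/
theorem range_grad2_subset (d : ℕ) : Set.range (grad2 d) ⊆ Set.range (grad1 d) := by
  rintro _ ⟨x, rfl⟩
  refine ⟨⟨WithLp.toLp 2 fun i => x.1 (.inl i), x.2.1, x.2.2.1⟩, rfl⟩

/-- Poincaré bounds `grad1` from below on a complete space. -/
theorem isClosed_range_grad1 (d : ℕ) : IsClosed (Set.range (grad1 d)) := by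
  have h : AntilipschitzWith 2 (grad1 d) := by
    refine (grad1 d).antilipschitz_of_bound fun x => ?_
    refine le_of_sq_le_sq ?_ (by positivity)
    have := norm_sq_le_grad1 x
    push_cast
    nlinarith [sq_nonneg ‖grad1 d x‖]
  exact h.isClosed_range (grad1 d).uniformContinuous

/-- Subtracting the mean moves `φ` into the mean-zero space without changing its derivatives. -/
theorem IsTest.exists_grad2 {d : ℕ} {φ : (Fin d → ℝ) → ℝ} (hφ : IsTest φ) :
    ∃ x : sobolev2 d, ∀ m, grad2 d x m = (hφ.fderiv_apply (Pi.single m 1)).toL2 := by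
  obtain ⟨c, hc⟩ : ∃ c : ℝ, c = ⨍ y in cell d, φ y := ⟨_, rfl⟩
  have hψ : IsTest (fun y => φ y - c) := ⟨hφ.1.sub contDiff_const, fun p y => by
    simp only [hφ.2 p y]⟩
  have hz : MeanZero hψ.toL2 := by
    rw [MeanZero, real_inner_comm, IsTest.inner_toL2]
    have e : ∫ y in cell d, (φ y - c) * (isTest_const d 1).toL2 y = ∫ y in cell d, (φ y - c) := by
      refine integral_congr_ae ?_
      filter_upwards [(isTest_const d 1).memL2.2.coeFn_toLp] with y hy
      rw [IsTest.toL2, hy, mul_one]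
    rw [e, integral_sub ((memLp_cell_of_continuous hφ.continuous 1).integrable le_rfl)
      (integrable_const c), hc, setAverage_eq, setIntegral_const, volume_real_cell]
    have := Real.two_pi_pos
    simp only [smul_eq_mul]
    field_simp
    simp
  have hd : ∀ m, HasWeakPartial m hψ.toL2 (hφ.fderiv_apply (Pi.single m 1)).toL2 := by
    intro m
    have h := hψ.hasWeakPartial m
    have e : (fun y => fderiv ℝ (fun y => φ y - c) y (Pi.single m 1)) =
        fun y => fderiv ℝ φ y (Pi.single m 1) := by
      funext y
      rw [fderiv_sub_const]
    simpa only [e] using h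
  refine ⟨⟨WithLp.toLp 2 (Sum.elim (fun o => Option.elim o hψ.toL2
    fun m => (hφ.fderiv_apply (Pi.single m 1)).toL2)
    fun q => ((hφ.fderiv_apply (Pi.single q.1 1)).fderiv_apply (Pi.single q.2 1)).toL2),
    hz, hd, fun m n => (hφ.fderiv_apply (Pi.single m 1)).hasWeakPartial n⟩, fun m => rfl⟩

/-- Testing with the gradient of a wave gives `|k|²` times a Fourier coefficient of `x`, so every
nonzero mode vanishes; the zero mode vanishes because the mean is zero. -/
theorem grad1_eq_zero_of_orthogonal {d : ℕ} (x : sobolev1 d)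
    (h : ∀ v, inner ℝ (grad2 d v) (grad1 d x) = 0) : grad1 d x = 0 := by
  have hw : ∀ k s, (∑ m, (k m : ℝ) ^ 2) * inner ℝ (isTest_wave k s).toL2 (x.1 none) = 0 := by
    intro k s
    obtain ⟨v, hv⟩ := (isTest_wave k s).exists_grad2
    have h1 := h v
    rw [PiLp.inner_apply] at h1
    have h2 : ∀ m, inner ℝ (grad2 d v m) (grad1 d x m) =
        (k m : ℝ) ^ 2 * inner ℝ (isTest_wave k s).toL2 (x.1 none) := by
      intro m
      have h3 : inner ℝ (grad2 d v m) (grad1 d x m) =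
          k m * inner ℝ (isTest_wave k (s + Real.pi / 2)).toL2 (x.1 (some m)) := by
        rw [hv, grad1_apply, IsTest.inner_toL2, IsTest.inner_toL2, ← integral_const_mul]
        simp only [fderiv_wave, mul_assoc]
      rw [h3, (x.2.2 m).inner_wave, IsTest.inner_toL2, IsTest.inner_toL2]
      have e : s + Real.pi / 2 + Real.pi / 2 = s + Real.pi := by ring
      simp only [e, wave_add_pi, neg_mul, integral_neg]
      ring
    simp only [h2, ← Finset.sum_mul] at h1
    exact h1
  have hm : ∀ k, modeEnergy k (x.1 none) = 0 := by
    intro k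
    rcases eq_or_ne k 0 with rfl | hk
    · exact x.2.1.modeEnergy_zero
    · have hk' := (zero_lt_one.trans_le (one_le_sum_sq hk)).ne'
      rw [modeEnergy_eq, (mul_eq_zero.1 (hw k 0)).resolve_left hk',
        (mul_eq_zero.1 (hw k _)).resolve_left hk']
      simp
  ext1 m
  rw [grad1_apply]
  exact L2Cell.eq_zero_of_modeEnergy fun k => by rw [(x.2.2 m).modeEnergy_eq, hm, mul_zero]

/-- Gradients of `H²` functions are dense in the gradients of `H¹` functions. -/
theorem grad1_mem_closure_range_grad2 {d : ℕ} (x : sobolev1 d) :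
    grad1 d x ∈ closure (Set.range (grad2 d)) := by
  let S : Submodule ℝ (L2Field d) := (grad2 d).range.topologicalClosure
  have hS : (S : Set (L2Field d)) = closure (Set.range (grad2 d)) := rfl
  have hSc : IsClosed (S : Set (L2Field d)) := Submodule.isClosed_topologicalClosure _
  have : CompleteSpace S := hSc.completeSpace_coe
  have hsub : (S : Set (L2Field d)) ⊆ Set.range (grad1 d) := by
    rw [hS]
    exact closure_minimal (range_grad2_subset d) (isClosed_range_grad1 d)
  -- The projection onto the closure is itself a gradient because gradients of `H¹` form a closed
  -- set. The residual is then the gradient of `x - z`, orthogonal to all `H²` gradients.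
  obtain ⟨z, hz⟩ := hsub (Submodule.starProjection_apply_mem S (grad1 d x))
  rw [← hS]
  have h0 : grad1 d (x - z) = 0 := by
    refine grad1_eq_zero_of_orthogonal _ fun v => ?_
    rw [map_sub, hz]
    refine (Submodule.sub_starProjection_mem_orthogonal (K := S) (grad1 d x)) _ ?_
    have : grad2 d v ∈ (S : Set (L2Field d)) := by
      rw [hS]
      exact subset_closure ⟨v, rfl⟩
    exact this
  rw [map_sub, hz, sub_eq_zero] at h0
  rw [h0]
  exact Submodule.starProjection_apply_mem _ _

/-! ### Singularly perturbed coercive variational problems -/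

section Abstract

variable {V K X : Type*} [NormedAddCommGroup V] [InnerProductSpace ℝ V]
  [NormedAddCommGroup K] [InnerProductSpace ℝ K] [NormedAddCommGroup X] [InnerProductSpace ℝ X]

/-- Existence and uniqueness for a coercive variational problem. -/
theorem existsUnique_of_isCoercive [CompleteSpace V] {B : V →L[ℝ] V →L[ℝ] ℝ}
    (hB : IsCoercive B) (f : V →L[ℝ] ℝ) : ∃! x, ∀ v, B x v = f v := by
  refine ⟨hB.continuousLinearEquivOfBilin.symm ((InnerProductSpace.toDual ℝ V).symm f),
    fun v => ?_, fun z hz => ?_⟩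
  · rw [← hB.continuousLinearEquivOfBilin_apply]
    simp
  · rw [ContinuousLinearEquiv.eq_symm_apply]
    symm
    exact hB.unique_continuousLinearEquivOfBilin fun w => by simp [hz]

/-- The form `r ⟪D x, D v⟫ + b (T x, T v)`. -/
noncomputable def perturbedForm (D : V →L[ℝ] X) (T : V →L[ℝ] K) (b : K →L[ℝ] K →L[ℝ] ℝ) (r : ℝ) :
    V →L[ℝ] V →L[ℝ] ℝ :=
  r • (isBoundedBilinearMap_inner (𝕜 := ℝ) (E := X)).toContinuousLinearMap.bilinearComp D D + b.bilinearComp T T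

theorem perturbedForm_apply (D : V →L[ℝ] X) (T : V →L[ℝ] K) (b : K →L[ℝ] K →L[ℝ] ℝ) (r : ℝ)
    (x v : V) : perturbedForm D T b r x v = r * inner ℝ (D x) (D v) + b (T x) (T v) := by
  rfl

/-- Coercivity comes from the `D` term alone; `b` only has to be nonnegative on the diagonal. -/
theorem existsUnique_perturbed [CompleteSpace V] (D : V →L[ℝ] X) (T : V →L[ℝ] K)
    {b : K →L[ℝ] K →L[ℝ] ℝ} {α : ℝ} (hα : 0 < α) (hb : ∀ p, α * ‖p‖ ^ 2 ≤ b p p)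
    {C : ℝ} (hC : 0 < C) (hV : ∀ x, ‖x‖ ^ 2 ≤ C * (‖D x‖ ^ 2)) {r : ℝ} (hr : 0 < r)
    (f : K →L[ℝ] ℝ) : ∃! x, ∀ v, r * inner ℝ (D x) (D v) + b (T x) (T v) = f (T v) := by
  have hB : IsCoercive (perturbedForm D T b r) := by
    refine ⟨r / C, by positivity, fun x => ?_⟩
    rw [perturbedForm_apply, real_inner_self_eq_norm_sq]
    have h1 := hV x
    have h2 : 0 ≤ b (T x) (T x) := le_trans (by positivity) (hb (T x))
    have h3 : r / C * ‖x‖ * ‖x‖ ≤ r * ‖D x‖ ^ 2 := by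
      calc r / C * ‖x‖ * ‖x‖ = r / C * ‖x‖ ^ 2 := by ring
        _ ≤ r / C * (C * ‖D x‖ ^ 2) := by gcongr
        _ = r * ‖D x‖ ^ 2 := by field_simp
    linarith
  simpa only [perturbedForm_apply] using! existsUnique_of_isCoercive hB (f.comp T)

theorem existsUnique_unperturbed [CompleteSpace V] (T : V →L[ℝ] K)
    {b : K →L[ℝ] K →L[ℝ] ℝ} {α : ℝ} (hα : 0 < α) (hb : ∀ p, α * ‖p‖ ^ 2 ≤ b p p)
    {C : ℝ} (hC : 0 < C) (hV : ∀ x, ‖x‖ ^ 2 ≤ C * (‖T x‖ ^ 2))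
    (f : K →L[ℝ] ℝ) : ∃! x, ∀ v, b (T x) (T v) = f (T v) := by
  have hB : IsCoercive (b.bilinearComp T T) := by
    refine ⟨α / C, by positivity, fun x => ?_⟩
    calc α / C * ‖x‖ * ‖x‖ = α / C * ‖x‖ ^ 2 := by ring
      _ ≤ α / C * (C * ‖T x‖ ^ 2) := by gcongr; exact hV x
      _ = α * ‖T x‖ ^ 2 := by field_simp
      _ ≤ b (T x) (T x) := hb _
  simpa using! existsUnique_of_isCoercive hB (f.comp T)

variable {D : V →L[ℝ] X} {T : V →L[ℝ] K} {b : K →L[ℝ] K →L[ℝ] ℝ} {α : ℝ} {f : K →L[ℝ] ℝ}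

/-- Test with `x` itself and apply Young's inequality, weighted so that the coercive term absorbs
all of `‖T x‖²`. -/
theorem perturbed_energy_bound (hα : 0 < α) (hb : ∀ p, α * ‖p‖ ^ 2 ≤ b p p) {r : ℝ}
    {x : V} (hx : ∀ v, r * inner ℝ (D x) (D v) + b (T x) (T v) = f (T v)) :
    r * ‖D x‖ ^ 2 ≤ ‖f‖ ^ 2 / (4 * α) := by
  have h := hx x
  rw [real_inner_self_eq_norm_sq] at h
  have h1 := hb (T x)
  have h2 : f (T x) ≤ ‖f‖ * ‖T x‖ := (le_abs_self _).trans (f.le_opNorm _)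
  have h3 : ‖f‖ * ‖T x‖ ≤ α * ‖T x‖ ^ 2 + ‖f‖ ^ 2 / (4 * α) := by
    have : 0 ≤ (2 * α * ‖T x‖ - ‖f‖) ^ 2 / (4 * α) := by positivity
    have e : (2 * α * ‖T x‖ - ‖f‖) ^ 2 / (4 * α) =
        α * ‖T x‖ ^ 2 + ‖f‖ ^ 2 / (4 * α) - ‖f‖ * ‖T x‖ := by
      field_simp
      ring
    linarith
  linarith

/-- Stability of the perturbed problem with respect to the parameter. -/
theorem perturbed_stability (hb : ∀ p, α * ‖p‖ ^ 2 ≤ b p p) {r s : ℝ} (hr : 0 < r) {x z : V}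
    (hx : ∀ v, r * inner ℝ (D x) (D v) + b (T x) (T v) = f (T v))
    (hz : ∀ v, s * inner ℝ (D z) (D v) + b (T z) (T v) = f (T v)) :
    α * ‖T x - T z‖ ^ 2 ≤ (s - r) ^ 2 / (4 * r) * ‖D z‖ ^ 2 := by
  have h1 := hx (x - z)
  have h2 := hz (x - z)
  have h3 := hb (T x - T z)
  -- Both equations are tested with `x - z` and subtracted; only the mismatch of the parameters
  -- remains.
  have e : r * inner ℝ (D (x - z)) (D (x - z)) + b (T x - T z) (T x - T z) =
      (s - r) * inner ℝ (D z) (D (x - z)) := by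
    simp only [map_sub, inner_sub_left, inner_sub_right, sub_apply] at *
    linear_combination h1 - h2
  rw [real_inner_self_eq_norm_sq] at e
  have h4 : (s - r) * inner ℝ (D z) (D (x - z)) ≤ |s - r| * (‖D z‖ * ‖D (x - z)‖) := by
    refine (le_abs_self _).trans ?_
    rw [abs_mul]
    gcongr
    exact abs_real_inner_le_norm _ _
  -- Young with weight `r`, so that the term in `D (x - z)` cancels exactly against the left side of
  -- `e`.
  have h5 : |s - r| * (‖D z‖ * ‖D (x - z)‖) ≤
      r * ‖D (x - z)‖ ^ 2 + (s - r) ^ 2 / (4 * r) * ‖D z‖ ^ 2 := by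
    have h6 : 0 ≤ (2 * r * ‖D (x - z)‖ - |s - r| * ‖D z‖) ^ 2 / (4 * r) := by positivity
    have e2 : (2 * r * ‖D (x - z)‖ - |s - r| * ‖D z‖) ^ 2 / (4 * r) =
        r * ‖D (x - z)‖ ^ 2 + |s - r| ^ 2 / (4 * r) * ‖D z‖ ^ 2 -
          |s - r| * (‖D z‖ * ‖D (x - z)‖) := by
      field_simp
      ring
    rw [sq_abs] at e2
    linarith
  linarith

/-- Distance of the solution of the perturbed problem to the solution `p` of the unperturbed one,
in terms of an approximation `T z` of `p`. -/
theorem perturbed_approx (hα : 0 < α) (hb : ∀ p, α * ‖p‖ ^ 2 ≤ b p p) {r : ℝ} (hr : 0 ≤ r) {x : V}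
    {p : K} (hx : ∀ v, r * inner ℝ (D x) (D v) + b (T x) (T v) = f (T v))
    (hp : ∀ v, b p (T v) = f (T v)) (z : V) :
    α / 2 * ‖T x - T z‖ ^ 2 ≤ r * ‖D z‖ ^ 2 / 4 + ‖b‖ ^ 2 * ‖T z - p‖ ^ 2 / (2 * α) := by
  have h1 := hx (x - z)
  have h2 := hp (x - z)
  have h3 := hb (T x - T z)
  -- Since `p` need not lie in the range of `T`, the comparison is with `z`. The two error terms are
  -- the cost of `D z` and the defect `T z - p`.
  have e : r * inner ℝ (D (x - z)) (D (x - z)) + b (T x - T z) (T x - T z) =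
      - r * inner ℝ (D z) (D (x - z)) - b (T z - p) (T x - T z) := by
    simp only [map_sub, inner_sub_left, inner_sub_right, sub_apply] at *
    linear_combination h1 - h2
  rw [real_inner_self_eq_norm_sq] at e
  have h4 : - inner ℝ (D z) (D (x - z)) ≤ ‖D (x - z)‖ ^ 2 + ‖D z‖ ^ 2 / 4 := by
    have := (neg_le_abs _).trans (abs_real_inner_le_norm (D z) (D (x - z)))
    nlinarith [sq_nonneg (‖D (x - z)‖ - ‖D z‖ / 2)]
  have h4' := mul_le_mul_of_nonneg_left h4 hr
  have h5 : - b (T z - p) (T x - T z) ≤ ‖b‖ * ‖T z - p‖ * ‖T x - T z‖ :=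
    (neg_le_abs _).trans (b.le_opNorm₂ _ _)
  have h6 : ‖b‖ * ‖T z - p‖ * ‖T x - T z‖ ≤
      α / 2 * ‖T x - T z‖ ^ 2 + ‖b‖ ^ 2 * ‖T z - p‖ ^ 2 / (2 * α) := by
    have h7 : 0 ≤ (α * ‖T x - T z‖ - ‖b‖ * ‖T z - p‖) ^ 2 / (2 * α) := by positivity
    have e2 : (α * ‖T x - T z‖ - ‖b‖ * ‖T z - p‖) ^ 2 / (2 * α) =
        α / 2 * ‖T x - T z‖ ^ 2 + ‖b‖ ^ 2 * ‖T z - p‖ ^ 2 / (2 * α) -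
          ‖b‖ * ‖T z - p‖ * ‖T x - T z‖ := by
      field_simp
      ring
    linarith
  linarith

variable {p : ℝ≥0 → K}

/-- The solutions of the perturbed problems depend continuously on the parameter, up to `0`. -/
theorem continuous_perturbed (hα : 0 < α) (hb : ∀ p, α * ‖p‖ ^ 2 ≤ b p p)
    (hp0 : p 0 ∈ closure (Set.range T)) (hpb : ∀ v, b (p 0) (T v) = f (T v))
    (hp : ∀ ρ : ℝ≥0, ρ ≠ 0 → ∃ x, p ρ = T x ∧
      ∀ v, (ρ : ℝ) ^ 2 * inner ℝ (D x) (D v) + b (T x) (T v) = f (T v)) :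
    Continuous p := by
  rw [continuous_iff_continuousAt]
  intro θ
  rw [ContinuousAt, tendsto_iff_norm_sub_tendsto_zero]
  rcases eq_or_ne θ 0 with rfl | hθ
  · rw [Metric.tendsto_nhds]
    intro ε hε
    -- The approximation error gets half of the budget `α / 2 * (ε / 2)²`. The other half goes to
    -- `ρ² ‖D z‖² / 4`, made small once `z` is fixed, as `‖D z‖` is not controlled in terms of `δ`.
    obtain ⟨δ, hδ, hδε, hδ2⟩ : ∃ δ : ℝ, 0 < δ ∧ δ ≤ ε / 2 ∧
        ‖b‖ ^ 2 * δ ^ 2 / (2 * α) ≤ α / 2 * (ε / 2) ^ 2 / 2 := by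
      have hl : Tendsto (fun δ : ℝ => ‖b‖ ^ 2 * δ ^ 2 / (2 * α)) (𝓝[>] 0) (𝓝 0) := by
        have : Continuous (fun δ : ℝ => ‖b‖ ^ 2 * δ ^ 2 / (2 * α)) := by fun_prop
        have h0 := this.tendsto 0
        simp only [ne_eq, OfNat.ofNat_ne_zero, not_false_eq_true, zero_pow, mul_zero,
          zero_div] at h0
        exact h0.mono_left nhdsWithin_le_nhds
      have h1 := hl.eventually
        (ge_mem_nhds (show (0 : ℝ) < α / 2 * (ε / 2) ^ 2 / 2 by positivity))
      have h2 : ∀ᶠ δ : ℝ in 𝓝[>] 0, δ ≤ ε / 2 :=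
        nhdsWithin_le_nhds (ge_mem_nhds (by positivity))
      obtain ⟨δ, ⟨ha, hb'⟩, hc⟩ := ((h1.and h2).and self_mem_nhdsWithin).exists
      exact ⟨δ, hc, hb', ha⟩
    obtain ⟨_, ⟨z, rfl⟩, hz⟩ := Metric.mem_closure_iff.1 hp0 δ hδ
    rw [dist_comm, dist_eq_norm] at hz
    have hl : Tendsto (fun ρ : ℝ≥0 => (ρ : ℝ) ^ 2 * ‖D z‖ ^ 2 / 4) (𝓝 0) (𝓝 0) := by
      have : Continuous (fun ρ : ℝ≥0 => (ρ : ℝ) ^ 2 * ‖D z‖ ^ 2 / 4) := by fun_prop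
      simpa using this.tendsto 0
    have hpos : 0 < α / 2 * (ε / 2) ^ 2 / 2 := by positivity
    filter_upwards [hl.eventually (gt_mem_nhds hpos)] with ρ hρ
    rw [dist_zero_right, norm_norm]
    rcases eq_or_ne ρ 0 with rfl | hρ0
    · simpa using hε
    obtain ⟨x, hx, hxv⟩ := hp ρ hρ0
    have h1 := perturbed_approx hα hb (sq_nonneg (ρ : ℝ)) hxv hpb z
    have h2 : ‖b‖ ^ 2 * ‖T z - p 0‖ ^ 2 / (2 * α) ≤ ‖b‖ ^ 2 * δ ^ 2 / (2 * α) := by gcongr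
    have h3 : α / 2 * ‖T x - T z‖ ^ 2 < α / 2 * (ε / 2) ^ 2 := by linarith
    have h4 : ‖T x - T z‖ < ε / 2 := by
      refine lt_of_pow_lt_pow_left₀ 2 (by positivity) ?_
      exact lt_of_mul_lt_mul_left h3 (by positivity)
    rw [hx]
    calc ‖T x - p 0‖ ≤ ‖T x - T z‖ + ‖T z - p 0‖ := norm_sub_le_norm_sub_add_norm_sub _ _ _
      _ < ε := by linarith
  -- Away from `0`, the solution at `θ` stays fixed and `ρ` varies, so the bound involves only the
  -- constant `‖D z‖`.
  · obtain ⟨z, hz, hzv⟩ := hp θ hθ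
    have hev : ∀ᶠ ρ in 𝓝 θ, ‖p ρ - p θ‖ ≤
        Real.sqrt ((((θ : ℝ) ^ 2 - (ρ : ℝ) ^ 2) ^ 2 / (4 * (ρ : ℝ) ^ 2) * ‖D z‖ ^ 2) / α) := by
      filter_upwards [isOpen_ne.mem_nhds hθ] with ρ hρ
      obtain ⟨x, hx, hxv⟩ := hp ρ hρ
      have hρ' : (0 : ℝ) < (ρ : ℝ) ^ 2 := by
        have : (0 : ℝ) < ρ := by exact_mod_cast pos_iff_ne_zero.2 hρ
        positivity
      refine Real.le_sqrt_of_sq_le ?_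
      rw [le_div_iff₀ hα, hx, hz, mul_comm]
      exact perturbed_stability hb hρ' hxv hzv
    have hlim : Tendsto (fun ρ : ℝ≥0 => Real.sqrt ((((θ : ℝ) ^ 2 - (ρ : ℝ) ^ 2) ^ 2 /
        (4 * (ρ : ℝ) ^ 2) * ‖D z‖ ^ 2) / α)) (𝓝 θ) (𝓝 0) := by
      have hθ' : (4 * (θ : ℝ) ^ 2) ≠ 0 := by simpa using hθ
      have h1 : ContinuousAt (fun ρ : ℝ≥0 => ((θ : ℝ) ^ 2 - (ρ : ℝ) ^ 2) ^ 2 /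
          (4 * (ρ : ℝ) ^ 2)) θ := by
        refine ContinuousAt.div ?_ ?_ hθ' <;> fun_prop
      have h2 := ((h1.mul_const (‖D z‖ ^ 2)).div_const α).sqrt
      simpa [ContinuousAt] using h2
    exact squeeze_zero' (Eventually.of_forall fun _ => norm_nonneg _) hev hlim

/-- The solutions of the perturbed problems vanish in the limit of infinite parameter. -/
theorem tendsto_perturbed_atTop (hα : 0 < α) (hb : ∀ p, α * ‖p‖ ^ 2 ≤ b p p)
    {C : ℝ} (hV : ∀ x, ‖x‖ ^ 2 ≤ C * (‖D x‖ ^ 2))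
    (hp : ∀ ρ : ℝ≥0, ρ ≠ 0 → ∃ x, p ρ = T x ∧
      ∀ v, (ρ : ℝ) ^ 2 * inner ℝ (D x) (D v) + b (T x) (T v) = f (T v)) :
    Tendsto p atTop (𝓝 0) := by
  -- The bound chains `‖T x‖ ≤ ‖T‖ ‖x‖`, the control of `x` by `D x`, and the energy bound on `ρ² ‖D
  -- x‖²`; `|C|` appears because no sign of `C` is assumed.
  have hlim : Tendsto (fun ρ : ℝ≥0 => Real.sqrt (‖T‖ ^ 2 * |C| * (‖f‖ ^ 2 / (4 * α)) /
      (ρ : ℝ) ^ 2)) atTop (𝓝 0) := by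
    have h1 : Tendsto (fun ρ : ℝ≥0 => (ρ : ℝ) ^ 2) atTop atTop :=
      (tendsto_pow_atTop two_ne_zero).comp (NNReal.tendsto_coe_atTop.2 tendsto_id)
    have h2 := (Real.continuous_sqrt.tendsto 0).comp
      (h1.const_div_atTop (‖T‖ ^ 2 * |C| * (‖f‖ ^ 2 / (4 * α))))
    rw [Real.sqrt_zero] at h2
    exact h2
  refine squeeze_zero_norm' ?_ hlim
  filter_upwards [eventually_gt_atTop 0] with ρ hρ
  obtain ⟨x, hx, hxv⟩ := hp ρ hρ.ne'
  have hρ' : (0 : ℝ) < (ρ : ℝ) ^ 2 := by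
    have : (0 : ℝ) < ρ := by exact_mod_cast hρ
    positivity
  have h1 := perturbed_energy_bound hα hb hxv
  refine Real.le_sqrt_of_sq_le ?_
  rw [le_div_iff₀ hρ', hx]
  calc ‖T x‖ ^ 2 * (ρ : ℝ) ^ 2 ≤ (‖T‖ * ‖x‖) ^ 2 * (ρ : ℝ) ^ 2 := by
        gcongr
        exact T.le_opNorm x
    _ = ‖T‖ ^ 2 * ‖x‖ ^ 2 * (ρ : ℝ) ^ 2 := by ring
    _ ≤ ‖T‖ ^ 2 * (|C| * ‖D x‖ ^ 2) * (ρ : ℝ) ^ 2 := by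
        gcongr
        exact (hV x).trans (by gcongr; exact le_abs_self C)
    _ = ‖T‖ ^ 2 * |C| * ((ρ : ℝ) ^ 2 * ‖D x‖ ^ 2) := by ring
    _ ≤ _ := by gcongr

end Abstract

/-! ### Periodic functions and their classes in `L²` -/

theorem inner_test_toLp {d : ℕ} {φ u : (Fin d → ℝ) → ℝ} (hφ : IsTest φ)
    (hu : MemLp u 2 (cellMeasure d)) :
    inner ℝ hφ.toL2 (hu.toLp u) = ∫ y in cell d, u y * φ y := by
  rw [hφ.inner_toL2]
  refine integral_congr_ae ?_
  filter_upwards [hu.coeFn_toLp] with y hy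
  rw [hy, mul_comm]

/-- The dictionary between periodic functions and classes on the cell. -/
theorem hasWeakPartial_toLp_iff {d : ℕ} {m : Fin d} {u g : (Fin d → ℝ) → ℝ}
    (hu : MemLp u 2 (cellMeasure d)) (hg : MemL2 g) :
    HasWeakPartial m (hu.toLp u) (hg.2.toLp g) ↔ IsWeakPartial m u g := by
  refine ⟨fun h => ⟨hg, fun φ hφ => ?_⟩, fun h φ hφ => ?_⟩
  · have := h φ hφ
    rw [inner_test_toLp, inner_test_toLp] at this
    linarith
  · rw [inner_test_toLp, inner_test_toLp, h.2 φ hφ]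
    ring

theorem IsWeakPartial.ae_eq {d : ℕ} {m : Fin d} {u g g' : (Fin d → ℝ) → ℝ} (hu : MemL2 u)
    (h : IsWeakPartial m u g) (h' : IsWeakPartial m u g') : g =ᵐ[cellMeasure d] g' :=
  (MemLp.toLp_eq_toLp_iff h.1.2 h'.1.2).1
    (((hasWeakPartial_toLp_iff hu.2 h.1).2 h).unique ((hasWeakPartial_toLp_iff hu.2 h'.1).2 h'))

theorem IsWeakPartial.congr {d : ℕ} {m : Fin d} {u u' g : (Fin d → ℝ) → ℝ}
    (h : IsWeakPartial m u g) (hu : u' =ᵐ[cellMeasure d] u) : IsWeakPartial m u' g := by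
  refine ⟨h.1, fun φ hφ => ?_⟩
  rw [← h.2 φ hφ]
  refine integral_congr_ae ?_
  filter_upwards [hu] with y hy
  rw [hy]

theorem isWeakPartial_weakPartial {d : ℕ} {m : Fin d} {u : (Fin d → ℝ) → ℝ}
    (h : ∃ g, IsWeakPartial m u g) : IsWeakPartial m u (weakPartial m u) := by
  rw [weakPartial, dif_pos h]
  exact h.choose_spec

theorem IsWeakPartial.weakPartial_ae_eq {d : ℕ} {m : Fin d} {u g : (Fin d → ℝ) → ℝ} (hu : MemL2 u)
    (h : IsWeakPartial m u g) : weakPartial m u =ᵐ[cellMeasure d] g :=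
  (isWeakPartial_weakPartial ⟨g, h⟩).ae_eq hu h

theorem toLp_comp_reduce {d : ℕ} (U : L2Cell d)
    (h : MemLp (fun y => U (reduce y)) 2 (cellMeasure d)) : h.toLp _ = U :=
  Lp.ext (h.coeFn_toLp.trans (comp_reduce_ae_eq _))

theorem HasWeakPartial.isWeakPartial {d : ℕ} {m : Fin d} {U G : L2Cell d}
    (h : HasWeakPartial m U G) :
    IsWeakPartial m (fun y => U (reduce y)) (fun y => G (reduce y)) := by
  have hU := memL2_comp_reduce (Lp.memLp U)
  have hG := memL2_comp_reduce (Lp.memLp G)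
  rwa [← hasWeakPartial_toLp_iff hU.2 hG, toLp_comp_reduce, toLp_comp_reduce]

theorem MemH1.isWeakPartial {d : ℕ} {u : (Fin d → ℝ) → ℝ} (hu : MemH1 u) (m : Fin d) :
    IsWeakPartial m u (weakPartial m u) :=
  isWeakPartial_weakPartial (hu.2 m)

theorem MemH2.memH1 {d : ℕ} {u : (Fin d → ℝ) → ℝ} (hu : MemH2 u) : MemH1 u :=
  ⟨hu.1, fun m => (hu.2 m).imp fun _ h => h.1⟩

/-- `MemH2` provides some derivative in `H¹`, while `weakPartial` is an arbitrary choice; uniqueness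
almost everywhere transfers the regularity. -/
theorem MemH2.memH1_weakPartial {d : ℕ} {u : (Fin d → ℝ) → ℝ} (hu : MemH2 u) (m : Fin d) :
    MemH1 (weakPartial m u) := by
  obtain ⟨g, hg, hg1⟩ := hu.2 m
  refine ⟨(hu.memH1.isWeakPartial m).1, fun n => ?_⟩
  obtain ⟨k, hk⟩ := hg1.2 n
  exact ⟨k, hk.congr (hg.weakPartial_ae_eq hu.1)⟩

/-- The class of `u` minus its mean. -/
noncomputable def centered {d : ℕ} {u : (Fin d → ℝ) → ℝ} (hu : MemLp u 2 (cellMeasure d)) :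
    L2Cell d :=
  (hu.sub (memLp_const (⨍ y in cell d, u y))).toLp (u - fun _ => ⨍ y in cell d, u y)

theorem centered_ae_eq {d : ℕ} {u : (Fin d → ℝ) → ℝ} (hu : MemLp u 2 (cellMeasure d)) :
    centered hu =ᵐ[cellMeasure d] fun x => u x - ⨍ y in cell d, u y :=
  MemLp.coeFn_toLp _

theorem meanZero_toLp_iff {d : ℕ} {u : (Fin d → ℝ) → ℝ} (hu : MemLp u 2 (cellMeasure d)) :
    MeanZero (hu.toLp u) ↔ ⨍ y in cell d, u y = 0 := by
  have := pow_pos Real.two_pi_pos d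
  rw [MeanZero, inner_test_toLp, setAverage_eq, volume_real_cell]
  simp

theorem meanZero_centered {d : ℕ} {u : (Fin d → ℝ) → ℝ} (hu : MemLp u 2 (cellMeasure d)) :
    MeanZero (centered hu) := by
  rw [centered, meanZero_toLp_iff, setAverage_eq]
  simp only [Pi.sub_apply]
  rw [integral_sub (hu.integrable (by norm_num)) (integrable_const _), setAverage_eq,
    setIntegral_const, volume_real_cell]
  have := Real.two_pi_pos
  simp only [smul_eq_mul]
  field_simp
  simp

theorem hasWeakPartial_centered {d : ℕ} {m : Fin d} {u g : (Fin d → ℝ) → ℝ}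
    (hu : MemLp u 2 (cellMeasure d)) (h : IsWeakPartial m u g) :
    HasWeakPartial m (centered hu) (h.1.2.toLp g) := by
  rw [centered, hasWeakPartial_toLp_iff _ h.1]
  refine ⟨h.1, fun φ hφ => ?_⟩
  rw [← h.2 φ hφ]
  simp only [Pi.sub_apply, sub_mul]
  have hd := (hφ.fderiv_apply (Pi.single m 1)).memL2.2
  have hi : Integrable (fun y => u y * fderiv ℝ φ y (Pi.single m 1)) (cellMeasure d) :=
    memLp_one_iff_integrable.1 (hd.mul hu)
  rw [integral_sub hi
    ((hd.integrable (by norm_num)).const_mul _), integral_const_mul,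
    hφ.integral_fderiv_eq_zero, mul_zero, sub_zero]

/-- Test functions in the cell problem may have nonzero mean. The weak form sees only derivatives,
so centering loses nothing. -/
theorem MemH1.exists_sobolev1 {d : ℕ} {u : (Fin d → ℝ) → ℝ} (hu : MemH1 u) :
    ∃ x : sobolev1 d, x.1 none =ᵐ[cellMeasure d] (fun x => u x - ⨍ y in cell d, u y) ∧
      ∀ m, weakPartial m u =ᵐ[cellMeasure d] grad1 d x m :=
  ⟨⟨WithLp.toLp 2 fun o => Option.elim o (centered hu.1.2)
      fun m => (hu.isWeakPartial m).1.2.toLp _,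
    meanZero_centered hu.1.2, fun m => hasWeakPartial_centered hu.1.2 (hu.isWeakPartial m)⟩,
    centered_ae_eq hu.1.2, fun m => (MemLp.coeFn_toLp (hu.isWeakPartial m).1.2).symm⟩

theorem exists_memH1 {d : ℕ} (x : sobolev1 d) :
    ∃ u, MemH1 u ∧ ⨍ y in cell d, u y = 0 ∧
      ∀ m, weakPartial m u =ᵐ[cellMeasure d] grad1 d x m := by
  have hu := memL2_comp_reduce (Lp.memLp (x.1 none))
  refine ⟨fun y => x.1 none (reduce y), ⟨hu, fun m => ⟨_, (x.2.2 m).isWeakPartial⟩⟩, ?_,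
    fun m => ((x.2.2 m).isWeakPartial.weakPartial_ae_eq hu).trans (comp_reduce_ae_eq _)⟩
  rw [← meanZero_toLp_iff hu.2, toLp_comp_reduce]
  exact x.2.1

theorem L2Cell.coeFn_sum {d : ℕ} {ι : Type*} (s : Finset ι) (U : ι → L2Cell d) :
    (∑ i ∈ s, U i : L2Cell d) =ᵐ[cellMeasure d] fun y => ∑ i ∈ s, U i y := by
  classical
  induction s using Finset.induction_on with
  | empty => simpa using! Lp.coeFn_zero ℝ 2 (cellMeasure d)
  | insert i s hi ih =>
    rw [Finset.sum_insert hi]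
    filter_upwards [Lp.coeFn_add (U i) (∑ i ∈ s, U i), ih] with y h1 h2
    rw [h1, Finset.sum_insert hi, Pi.add_apply, h2]

theorem laplacian2_ae_eq {d : ℕ} {x : sobolev2 d} {u : (Fin d → ℝ) → ℝ}
    (h : ∀ m, weakPartial m (weakPartial m u) =ᵐ[cellMeasure d] x.1 (.inr (m, m))) :
    weakLaplacian u =ᵐ[cellMeasure d] laplacian2 d x := by
  rw [laplacian2_apply]
  have h1 := L2Cell.coeFn_sum Finset.univ (fun m => x.1 (.inr (m, m)))
  filter_upwards [h1, ae_all_iff.2 h] with y hy hy2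
  rw [hy, weakLaplacian]
  exact Finset.sum_congr rfl fun m _ => hy2 m

theorem MemH2.exists_sobolev2 {d : ℕ} {u : (Fin d → ℝ) → ℝ} (hu : MemH2 u) :
    ∃ x : sobolev2 d, x.1 (.inl none) =ᵐ[cellMeasure d] (fun x => u x - ⨍ y in cell d, u y) ∧
      (∀ m, weakPartial m u =ᵐ[cellMeasure d] grad2 d x m) ∧
      weakLaplacian u =ᵐ[cellMeasure d] laplacian2 d x :=
  ⟨⟨WithLp.toLp 2 (Sum.elim (fun o => Option.elim o (centered hu.1.2)
      fun m => (hu.memH1.isWeakPartial m).1.2.toLp _)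
      fun q => ((hu.memH1_weakPartial q.1).isWeakPartial q.2).1.2.toLp _),
    meanZero_centered hu.1.2,
    fun m => hasWeakPartial_centered hu.1.2 (hu.memH1.isWeakPartial m),
    fun m n => (hasWeakPartial_toLp_iff (hu.memH1.isWeakPartial m).1.2
      ((hu.memH1_weakPartial m).isWeakPartial n).1).2 ((hu.memH1_weakPartial m).isWeakPartial n)⟩,
    centered_ae_eq hu.1.2, fun m => (MemLp.coeFn_toLp (hu.memH1.isWeakPartial m).1.2).symm,
    laplacian2_ae_eq fun m =>
      (MemLp.coeFn_toLp ((hu.memH1_weakPartial m).isWeakPartial m).1.2).symm⟩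

theorem exists_memH2 {d : ℕ} (x : sobolev2 d) :
    ∃ u, MemH2 u ∧ ⨍ y in cell d, u y = 0 ∧
      (∀ m, weakPartial m u =ᵐ[cellMeasure d] grad2 d x m) ∧
      weakLaplacian u =ᵐ[cellMeasure d] laplacian2 d x := by
  have hu := memL2_comp_reduce (Lp.memLp (x.1 (.inl none)))
  have hg := fun m => memL2_comp_reduce (Lp.memLp (x.1 (.inl (some m))))
  have hw : ∀ m, weakPartial m (fun y => x.1 (.inl none) (reduce y)) =ᵐ[cellMeasure d]
      fun y => x.1 (.inl (some m)) (reduce y) :=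
    fun m => (x.2.2.1 m).isWeakPartial.weakPartial_ae_eq hu
  refine ⟨fun y => x.1 (.inl none) (reduce y), ⟨hu, fun m => ⟨_, (x.2.2.1 m).isWeakPartial,
    hg m, fun n => ⟨_, (x.2.2.2 m n).isWeakPartial⟩⟩⟩, ?_,
    fun m => (hw m).trans (comp_reduce_ae_eq _), laplacian2_ae_eq fun m => ?_⟩
  · rw [← meanZero_toLp_iff hu.2, toLp_comp_reduce]
    exact x.2.1
  · refine (IsWeakPartial.weakPartial_ae_eq (m := m) ?_
      ((x.2.2.2 m m).isWeakPartial.congr (hw m))).trans (comp_reduce_ae_eq _)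
    exact (isWeakPartial_weakPartial ⟨_, (x.2.2.1 m).isWeakPartial⟩).1

/-! ### The bilinear form of the coefficient matrix -/

/-- `P` is a representative of the square integrable vector field `p`. -/
def Represents {d : ℕ} (P : (Fin d → ℝ) → Fin d → ℝ) (p : L2Field d) : Prop :=
  ∀ m, (fun y => P y m) =ᵐ[cellMeasure d] p m

theorem Represents.add {d : ℕ} {P Q : (Fin d → ℝ) → Fin d → ℝ} {p q : L2Field d}
    (hP : Represents P p) (hQ : Represents Q q) : Represents (P + Q) (p + q) := fun m => by
  filter_upwards [hP m, hQ m, Lp.coeFn_add (p m) (q m)] with y h1 h2 h3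
  rw [PiLp.add_apply, h3]
  simp [h1, h2]

/-- The constant coordinate vector field. -/
noncomputable def coordField {d : ℕ} (j : Fin d) : L2Field d :=
  WithLp.toLp 2 fun m => (isTest_const d ((Pi.single j (1 : ℝ) : Fin d → ℝ) m)).toL2

theorem represents_coordField {d : ℕ} (j : Fin d) :
    Represents (fun _ => Pi.single j 1) (coordField j) :=
  fun _ => (MemLp.coeFn_toLp (isTest_const d _).memL2.2).symm

theorem IsAdmissible.memLp_top {d : ℕ} {A : (Fin d → ℝ) → Matrix (Fin d) (Fin d) ℝ}
    (hA : IsAdmissible A) (k l : Fin d) : MemLp (fun y => A y k l) ⊤ (cellMeasure d) := by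
  obtain ⟨M, hM⟩ := hA.bounded
  refine memLp_top_of_bound (hA.measurable k l).restrict.aestronglyMeasurable M ?_
  filter_upwards [ae_restrict_of_ae hM] with y hy
  exact hy k l

theorem IsAdmissible.integrable_mul {d : ℕ} {A : (Fin d → ℝ) → Matrix (Fin d) (Fin d) ℝ}
    (hA : IsAdmissible A) (k l : Fin d) (U W : L2Cell d) :
    Integrable (fun y => A y k l * U y * W y) (cellMeasure d) := by
  have h : MemLp (fun y => A y k l * U y) 2 (cellMeasure d) :=
    (Lp.memLp U).mul (hA.memLp_top k l)
  exact memLp_one_iff_integrable.1 ((Lp.memLp W).mul h)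

theorem dotProduct_mulVec_ae_eq {d : ℕ} (A : (Fin d → ℝ) → Matrix (Fin d) (Fin d) ℝ)
    {P Q : (Fin d → ℝ) → Fin d → ℝ} {p q : L2Field d} (hP : Represents P p)
    (hQ : Represents Q q) : (fun y => (A y *ᵥ P y) ⬝ᵥ Q y) =ᵐ[cellMeasure d]
      fun y => ∑ k, ∑ m, A y k m * p m y * q k y := by
  filter_upwards [ae_all_iff.2 hP, ae_all_iff.2 hQ] with y h1 h2
  simp only [dotProduct, Matrix.mulVec, Finset.sum_mul, h1, h2]

/-- Bounded entries act on `L²` by multiplication, and pointwise ellipticity integrates to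
coercivity. The form lives on all vector fields, not just gradients, so that it also accepts the
constant fields `e_j`. -/
theorem IsAdmissible.exists_form {d : ℕ} {A : (Fin d → ℝ) → Matrix (Fin d) (Fin d) ℝ}
    (hA : IsAdmissible A) : ∃ b : L2Field d →L[ℝ] L2Field d →L[ℝ] ℝ,
      (∀ P Q p q, Represents P p → Represents Q q →
        b p q = ∫ y in cell d, (A y *ᵥ P y) ⬝ᵥ Q y) ∧
      ∃ α : ℝ, 0 < α ∧ ∀ p, α * ‖p‖ ^ 2 ≤ b p p := by
  let M : Fin d → Fin d → L2Cell d →L[ℝ] L2Cell d := fun k m =>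
    (ContinuousLinearMap.mul ℝ ℝ).holderL (cellMeasure d) ⊤ 2 2 ((hA.memLp_top k m).toLp _)
  have hM : ∀ k m U W, inner ℝ (M k m U) W = ∫ y in cell d, A y k m * U y * W y := by
    intro k m U W
    rw [L2.inner_def]
    refine integral_congr_ae ?_
    filter_upwards [(ContinuousLinearMap.mul ℝ ℝ).coeFn_holder (r := 2)
      ((hA.memLp_top k m).toLp _) U, (hA.memLp_top k m).coeFn_toLp] with y h1 h2
    have h3 : M k m U y = A y k m * U y := by
      refine h1.trans ?_
      rw [h2]
      rfl
    simp [h3, mul_comm]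
  let b : L2Field d →L[ℝ] L2Field d →L[ℝ] ℝ := ∑ k, ∑ m,
    (isBoundedBilinearMap_inner (𝕜 := ℝ) (E := L2Cell d)).toContinuousLinearMap.bilinearComp
      (M k m ∘L PiLp.proj 2 (fun _ : Fin d => L2Cell d) m)
      (PiLp.proj 2 (fun _ : Fin d => L2Cell d) k)
  have hb : ∀ p q, b p q = ∑ k, ∑ m, inner ℝ (M k m (p m)) (q k) := by
    intro p q
    simp only [b, sum_apply]
    rfl
  have hform : ∀ P Q p q, Represents P p → Represents Q q →
      b p q = ∫ y in cell d, (A y *ᵥ P y) ⬝ᵥ Q y := by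
    intro P Q p q hP hQ
    rw [hb, integral_congr_ae (dotProduct_mulVec_ae_eq A hP hQ), integral_finsetSum]
    · refine Finset.sum_congr rfl fun k _ => ?_
      rw [integral_finsetSum _ fun m _ => hA.integrable_mul k m (p m) (q k)]
      exact Finset.sum_congr rfl fun m _ => hM k m _ _
    · exact fun k _ => integrable_finsetSum _ fun m _ => hA.integrable_mul k m (p m) (q k)
  obtain ⟨α, hα, hell⟩ := hA.elliptic
  refine ⟨b, hform, α, hα, fun p => ?_⟩
  have hp : Represents (fun y m => p m y) p := fun m => EventuallyEq.rfl
  have hsq : ∀ m, Integrable (fun y => p m y * p m y) (cellMeasure d) := fun m =>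
    memLp_one_iff_integrable.1 ((Lp.memLp (p m)).mul (Lp.memLp (p m)))
  rw [hform _ _ p p hp hp, PiLp.norm_sq_eq_of_L2]
  have e : ∑ m, ‖p m‖ ^ 2 = ∫ y in cell d, ∑ m, p m y * p m y := by
    rw [integral_finsetSum _ fun m _ => hsq m]
    refine Finset.sum_congr rfl fun m _ => ?_
    rw [← real_inner_self_eq_norm_sq, L2.inner_def]
    simp [sq]
  rw [e, ← integral_const_mul]
  refine integral_mono_ae ((integrable_finsetSum _ fun m _ => hsq m).const_mul α) ?_ ?_
  · refine (integrable_congr (dotProduct_mulVec_ae_eq A hp hp)).2 ?_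
    exact integrable_finsetSum _ fun k _ => integrable_finsetSum _ fun m _ =>
      hA.integrable_mul k m (p m) (p k)
  · filter_upwards [ae_restrict_of_ae hell] with y hy
    exact hy fun m => p m y

/-! ### Correctors -/

section Correctors

variable {d : ℕ} {A : (Fin d → ℝ) → Matrix (Fin d) (Fin d) ℝ}
  {b : L2Field d →L[ℝ] L2Field d →L[ℝ] ℝ}

/-- This isolates the source term, identifying the right-hand side of the abstract problem as `-b
(coordField j)`. -/
theorem form_corrector (hb : ∀ P Q p q, Represents P p → Represents Q q →
      b p q = ∫ y in cell d, (A y *ᵥ P y) ⬝ᵥ Q y) (j : Fin d) {χ v : (Fin d → ℝ) → ℝ}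
    {p q : L2Field d} (hp : Represents (weakGrad χ) p) (hq : Represents (weakGrad v) q) :
    ∫ y in cell d, (A y *ᵥ (Pi.single j 1 + weakGrad χ y)) ⬝ᵥ weakGrad v y =
      b p q - (-b (coordField j)) q := by
  have := hb _ _ _ _ ((represents_coordField j).add hp) hq
  rw [map_add, add_apply] at this
  rw [neg_apply]
  simp only [Pi.add_apply] at this
  linarith

theorem L2Cell.inner_eq_integral {U W : L2Cell d} {u w : (Fin d → ℝ) → ℝ}
    (hu : u =ᵐ[cellMeasure d] U) (hw : w =ᵐ[cellMeasure d] W) :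
    ∫ y in cell d, u y * w y = inner ℝ U W := by
  rw [L2.inner_def]
  refine integral_congr_ae ?_
  filter_upwards [hu, hw] with y h1 h2
  rw [h1, h2]
  simp [mul_comm]

theorem IsCorrector.exists_sobolev1 (hb : ∀ P Q p q, Represents P p → Represents Q q →
      b p q = ∫ y in cell d, (A y *ᵥ P y) ⬝ᵥ Q y) {j : Fin d} {χ : (Fin d → ℝ) → ℝ}
    (h : IsCorrector A 0 j χ) : ∃ x : sobolev1 d, x.1 none =ᵐ[cellMeasure d] χ ∧
      Represents (weakGrad χ) (grad1 d x) ∧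
      ∀ v, b (grad1 d x) (grad1 d v) = (-b (coordField j)) (grad1 d v) := by
  obtain ⟨h1, h0, h2⟩ := h
  obtain ⟨-, h1⟩ | ⟨h1, -⟩ := h1
  swap
  · exact absurd rfl h1
  obtain ⟨x, hx0, hx1⟩ := h1.exists_sobolev1
  refine ⟨x, ?_, hx1, fun v => ?_⟩
  · simpa [h0] using hx0
  obtain ⟨w, hw, -, hw1⟩ := exists_memH1 v
  have := h2 w (Or.inl ⟨rfl, hw⟩)
  rw [form_corrector hb j hx1 hw1] at this
  linarith

theorem exists_isCorrector_zero (hb : ∀ P Q p q, Represents P p → Represents Q q →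
      b p q = ∫ y in cell d, (A y *ᵥ P y) ⬝ᵥ Q y) {j : Fin d} {x : sobolev1 d}
    (h : ∀ v, b (grad1 d x) (grad1 d v) = (-b (coordField j)) (grad1 d v)) :
    ∃ χ, IsCorrector A 0 j χ := by
  obtain ⟨u, hu, hu0, hu1⟩ := exists_memH1 x
  refine ⟨u, Or.inl ⟨rfl, hu⟩, hu0, fun v hv => ?_⟩
  obtain ⟨-, hv⟩ | ⟨hv, -⟩ := hv
  swap
  · exact absurd rfl hv
  obtain ⟨w, -, hw1⟩ := hv.exists_sobolev1
  rw [form_corrector hb j hu1 hw1, h w]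
  ring

theorem IsCorrector.exists_sobolev2 (hb : ∀ P Q p q, Represents P p → Represents Q q →
      b p q = ∫ y in cell d, (A y *ᵥ P y) ⬝ᵥ Q y) {ρ : ℝ} (hρ : ρ ≠ 0) {j : Fin d}
    {χ : (Fin d → ℝ) → ℝ}
    (h : IsCorrector A ρ j χ) : ∃ x : sobolev2 d, x.1 (.inl none) =ᵐ[cellMeasure d] χ ∧
      Represents (weakGrad χ) (grad2 d x) ∧
      ∀ v, ρ ^ 2 * inner ℝ (laplacian2 d x) (laplacian2 d v) + b (grad2 d x) (grad2 d v) =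
        (-b (coordField j)) (grad2 d v) := by
  obtain ⟨h1, h0, h2⟩ := h
  obtain ⟨h1, -⟩ | ⟨-, h1⟩ := h1
  · exact absurd h1 hρ
  obtain ⟨x, hx0, hx1, hx2⟩ := h1.exists_sobolev2
  refine ⟨x, ?_, hx1, fun v => ?_⟩
  · simpa [h0] using hx0
  obtain ⟨w, hw, -, hw1, hw2⟩ := exists_memH2 v
  have := h2 w (Or.inr ⟨hρ, hw⟩)
  rw [form_corrector hb j hx1 hw1, L2Cell.inner_eq_integral hx2 hw2] at this
  linarith

theorem exists_isCorrector (hb : ∀ P Q p q, Represents P p → Represents Q q →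
      b p q = ∫ y in cell d, (A y *ᵥ P y) ⬝ᵥ Q y) {ρ : ℝ} (hρ : ρ ≠ 0) {j : Fin d}
    {x : sobolev2 d}
    (h : ∀ v, ρ ^ 2 * inner ℝ (laplacian2 d x) (laplacian2 d v) + b (grad2 d x) (grad2 d v) =
        (-b (coordField j)) (grad2 d v)) :
    ∃ χ, IsCorrector A ρ j χ := by
  obtain ⟨u, hu, hu0, hu1, hu2⟩ := exists_memH2 x
  refine ⟨u, Or.inr ⟨hρ, hu⟩, hu0, fun v hv => ?_⟩
  obtain ⟨hv, -⟩ | ⟨-, hv⟩ := hv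
  · exact absurd hv hρ
  obtain ⟨w, -, hw1, hw2⟩ := hv.exists_sobolev2
  rw [form_corrector hb j hu1 hw1, L2Cell.inner_eq_integral hu2 hw2, ← h w]
  ring

theorem IsCorrector.aePeriodic {ρ : ℝ} {j : Fin d} {χ : (Fin d → ℝ) → ℝ}
    (h : IsCorrector A ρ j χ) : AEPeriodic χ := by
  obtain ⟨-, h⟩ | ⟨-, h⟩ := h.1
  · exact h.1.1
  · exact h.1.1

/-- Well-posedness of the cell problems. -/
theorem IsAdmissible.corrector_existence_uniqueness (hA : IsAdmissible A) (ρ : ℝ≥0) (j : Fin d) :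
    (∃ χ, IsCorrector A ρ j χ) ∧ ∀ χ χ' : (Fin d → ℝ) → ℝ, IsCorrector A ρ j χ →
      IsCorrector A ρ j χ' → χ =ᵐ[volume] χ' := by
  obtain ⟨b, hb, α, hα, hell⟩ := hA.exists_form
  rcases eq_or_ne ρ 0 with rfl | hρ
  · obtain ⟨x, hx, huniq⟩ := existsUnique_unperturbed (grad1 d) hα hell two_pos
      norm_sq_le_grad1 (-b (coordField j))
    refine ⟨exists_isCorrector_zero hb hx, fun χ χ' h h' => h.aePeriodic.ae_eq h'.aePeriodic ?_⟩
    obtain ⟨z, hz, -, hz'⟩ := IsCorrector.exists_sobolev1 hb h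
    obtain ⟨w, hw, -, hw'⟩ := IsCorrector.exists_sobolev1 hb h'
    rw [huniq z hz'] at hz
    rw [huniq w hw'] at hw
    exact hz.symm.trans hw
  · have hρ' : (ρ : ℝ) ≠ 0 := by exact_mod_cast hρ
    obtain ⟨x, hx, huniq⟩ := existsUnique_perturbed (laplacian2 d) (grad2 d) hα hell
      (C := 1 + d + d * d) (by positivity) norm_sq_le_laplacian2
      (r := (ρ : ℝ) ^ 2) (by positivity) (-b (coordField j))
    refine ⟨exists_isCorrector hb hρ' hx, fun χ χ' h h' => h.aePeriodic.ae_eq h'.aePeriodic ?_⟩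
    obtain ⟨z, hz, -, hz'⟩ := IsCorrector.exists_sobolev2 hb hρ' h
    obtain ⟨w, hw, -, hw'⟩ := IsCorrector.exists_sobolev2 hb hρ' h'
    rw [huniq z hz'] at hz
    rw [huniq w hw'] at hw
    exact hz.symm.trans hw

theorem isCorrector_corrector (hA : IsAdmissible A) (ρ : ℝ≥0) (j : Fin d) :
    IsCorrector A ρ j (corrector A ρ j) := by
  rw [corrector, dif_pos (hA.corrector_existence_uniqueness ρ j).1]
  exact (hA.corrector_existence_uniqueness ρ j).1.choose_spec

/-- Pairing `A p` with the constant field `e_k` extracts its `k`-th mean. Convergence of gradients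
in `L²` therefore suffices for convergence of the tensors. -/
theorem homTensor_apply (hA : IsAdmissible A) (hb : ∀ P Q p q, Represents P p → Represents Q q →
      b p q = ∫ y in cell d, (A y *ᵥ P y) ⬝ᵥ Q y) {ρ : ℝ} {l : Fin d} {p : L2Field d}
    (hp : Represents (weakGrad (corrector A ρ l)) p) (k : Fin d) :
    homTensor A ρ k l = meanMatrix A k l + ((2 * Real.pi) ^ d)⁻¹ * b p (coordField k) := by
  have h1 := hb _ _ _ _ hp (represents_coordField k)
  simp only [dotProduct_single, mul_one] at h1
  have hi : Integrable (fun y => (A y *ᵥ weakGrad (corrector A ρ l) y) k) (cellMeasure d) := by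
    have h2 : (fun y => (A y *ᵥ weakGrad (corrector A ρ l) y) k) =ᵐ[cellMeasure d]
        fun y => ∑ m, A y k m * p m y := by
      filter_upwards [ae_all_iff.2 hp] with y hy
      simp only [Matrix.mulVec, dotProduct, hy]
    refine (integrable_congr h2).2 (integrable_finsetSum _ fun m _ => ?_)
    have : MemLp (fun y => A y k m * p m y) 2 (cellMeasure d) :=
      (Lp.memLp (p m)).mul (hA.memLp_top k m)
    exact this.integrable (by norm_num)
  rw [homTensor, meanMatrix, Matrix.of_apply, Matrix.of_apply, setAverage_eq, setAverage_eq,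
    volume_real_cell, integral_add ((hA.memLp_top k l).integrable le_top) hi, h1, smul_add,
    smul_eq_mul, smul_eq_mul]

/-- The gradients of the correctors form a continuous family of square integrable fields, vanishing
at infinity. -/
theorem IsAdmissible.exists_corrector_gradient (hA : IsAdmissible A)
    (hb : ∀ P Q p q, Represents P p → Represents Q q →
      b p q = ∫ y in cell d, (A y *ᵥ P y) ⬝ᵥ Q y) {α : ℝ} (hα : 0 < α)
    (hell : ∀ p, α * ‖p‖ ^ 2 ≤ b p p) (l : Fin d) :
    ∃ p : ℝ≥0 → L2Field d, (∀ ρ : ℝ≥0, Represents (weakGrad (corrector A ρ l)) (p ρ)) ∧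
      Continuous p ∧ Tendsto p atTop (𝓝 0) := by
  have h : ∀ ρ : ℝ≥0, ∃ q : L2Field d, Represents (weakGrad (corrector A ρ l)) q ∧
      (ρ = 0 → ∃ x, q = grad1 d x ∧
        ∀ v, b (grad1 d x) (grad1 d v) = (-b (coordField l)) (grad1 d v)) ∧
      (ρ ≠ 0 → ∃ x, q = grad2 d x ∧ ∀ v, (ρ : ℝ) ^ 2 *
        inner ℝ (laplacian2 d x) (laplacian2 d v) + b (grad2 d x) (grad2 d v) =
          (-b (coordField l)) (grad2 d v)) := by
    intro ρ
    have hc := isCorrector_corrector hA ρ l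
    rcases eq_or_ne ρ 0 with rfl | hρ
    · obtain ⟨x, -, hx, hx'⟩ := IsCorrector.exists_sobolev1 hb hc
      exact ⟨_, hx, fun _ => ⟨x, rfl, hx'⟩, fun h => absurd rfl h⟩
    · have hρ' : (ρ : ℝ) ≠ 0 := by exact_mod_cast hρ
      obtain ⟨x, -, hx, hx'⟩ := IsCorrector.exists_sobolev2 hb hρ' hc
      exact ⟨_, hx, fun h => absurd h hρ, fun _ => ⟨x, rfl, hx'⟩⟩
  choose p hp hp0 hp1 using h
  obtain ⟨x, hx, hx'⟩ := hp0 0 rfl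
  refine ⟨p, hp, ?_, tendsto_perturbed_atTop hα hell norm_sq_le_laplacian2 hp1⟩
  refine continuous_perturbed hα hell ?_ (fun v => ?_) hp1
  · rw [hx]
    exact grad1_mem_closure_range_grad2 x
  -- The limit equation holds for `H¹` test functions, in particular for those from `H²`.
  · obtain ⟨w, hw⟩ := range_grad2_subset d ⟨v, rfl⟩
    rw [hx, ← hw]
    exact hx' w

theorem IsAdmissible.tendsto_homTensor (hA : IsAdmissible A) (θ : ℝ≥0∞) {ι : Type*}
    (l : Filter ι) (ρ : ι → ℝ≥0) (hρ : Tendsto (fun i => (ρ i : ℝ≥0∞)) l (𝓝 θ)) :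
    Tendsto (fun i => homTensor A (ρ i)) l (𝓝 (limitTensor A θ)) := by
  obtain ⟨b, hb, α, hα, hell⟩ := hA.exists_form
  refine tendsto_pi_nhds.2 fun k => tendsto_pi_nhds.2 fun j => ?_
  obtain ⟨p, hp, hpc, hpt⟩ := hA.exists_corrector_gradient hb hα hell j
  simp only [fun i => homTensor_apply hA hb (hp (ρ i)) k]
  have hc : Continuous fun q : L2Field d =>
      meanMatrix A k j + ((2 * Real.pi) ^ d)⁻¹ * b q (coordField k) := by fun_prop
  rcases eq_or_ne θ ⊤ with rfl | hθ
  · have h1 : Tendsto ρ l atTop := ENNReal.tendsto_coe_nhds_top.1 hρ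
    -- At the zero gradient the affine expression reduces to the mean of `A`, which is the limit
    -- tensor for `θ = ∞`.
    have h2 := (hc.tendsto 0).comp (hpt.comp h1)
    simpa [limitTensor] using! h2
  · lift θ to ℝ≥0 using hθ
    have h1 : Tendsto ρ l (𝓝 θ) := ENNReal.tendsto_coe.1 hρ
    have h2 := ((hc.comp hpc).tendsto θ).comp h1
    rw [limitTensor, if_neg ENNReal.coe_ne_top, ENNReal.coe_toReal,
      homTensor_apply hA hb (hp θ) k]
    exact h2

end Correctors

end PeriodicHom

theorem theorem5p3 {d : ℕ} (A : (Fin d → ℝ) → Matrix (Fin d) (Fin d) ℝ)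
    (hA : PeriodicHom.IsAdmissible A) :
    (∀ (ρ : ℝ≥0) (j : Fin d),
      (∃ χ, PeriodicHom.IsCorrector A ρ j χ) ∧
      ∀ χ χ' : (Fin d → ℝ) → ℝ, PeriodicHom.IsCorrector A ρ j χ →
        PeriodicHom.IsCorrector A ρ j χ' → χ =ᵐ[volume] χ') ∧
    ∀ (θ : ℝ≥0∞) {ι : Type*} (l : Filter ι) (ρ : ι → ℝ≥0),
      Tendsto (fun i => (ρ i : ℝ≥0∞)) l (𝓝 θ) →
      Tendsto (fun i => PeriodicHom.homTensor A (ρ i)) l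
        (𝓝 (PeriodicHom.limitTensor A θ)) :=
  ⟨fun ρ j => hA.corrector_existence_uniqueness ρ j,
    fun θ _ l ρ hρ => hA.tendsto_homTensor θ l ρ hρ⟩
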